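/- In the partial match problem for parameters $n,d$, Alice holds a pattern $q\in\{0,1,\star\}^d$ and Bob holds a database of $n$ strings (not necessarily distinct) in $\{0,1\}^d$; the question is whether some string $p$ of the database matches $q$, i.e. for every coordinate $i$ either $q_i=\star$ or $q_i=p_i$. Assume throughout that $1\le n\le 2^d$. Fix constants $\varepsilon>0$ and $\eta<1/2$. (1) (Communication.) There is a constant $c>0$, depending only on $\varepsilon$ and $\eta$, such that for all $n,d$ with $1\le n\le 2^d$ and every randomized (public-coin) two-party protocol that solves partial match with error probability at most $\eta$ on every input: if Alice sends at most $a$ bits and Bob sends at most $b$ bits in every execution, then $a\ge c\,d$ or $b\ge c\,n^{1-\varepsilon}$. (2) (Cell-probe data structures.) There is a constant $c>0$, depending only on $\varepsilon$ and $\eta$, such that for every constant $C>0$ there is an $n_0$ such that the following holds for all $n\ge n_0$, all $d$ with $n\le 2^d$, and all integers $t\ge 1$, $w,S\ge 0$ with $w\le C\,n^{1-\varepsilon}/t$. Every cell-probe data structure that stores a database of $n$ strings in $\{0,1\}^d$ in $S$ cells of $w$ bits each and answers every partial match query, deterministically or with randomization and error probability at most $\eta$, with at most $t$ (adaptive) cell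 probes, uses space $S\ge 2^{c\,d/t}$. -/

import Mathlib

open scoped ENNReal

/-- A pattern in `{0,1,⋆}^d`; the value `none` stands for the symbol `⋆`. -/
abbrev Pattern (d : ℕ) : Type := Fin d → Option Bool

/-- A database of `n` strings in `{0,1}^d`. -/
abbrev Database (n d : ℕ) : Type := Fin n → Fin d → Bool

/-- A pattern matches a string if in every coordinate it is `⋆` or agrees with the string. -/
def Pattern.Matches {d : ℕ} (q : Pattern d) (p : Fin d → Bool) : Prop :=
  ∀ i, q i = none ∨ q i = some (p i)

/-- The partial match problem: does some string of the database match the pattern? -/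
def PartialMatch {n d : ℕ} (q : Pattern d) (D : Database n d) : Prop :=
  ∃ j, q.Matches (D j)

/-- Deterministic two-party protocols as protocol trees. At each inner node, one of the players
sends one bit, which depends on the player's own input (and on the node, that is, on the bits
sent so far). A leaf carries the output. -/
inductive Protocol (X Y : Type) : Type
  | output (r : Bool) : Protocol X Y
  | alice (msg : X → Bool) (next : Bool → Protocol X Y) : Protocol X Y
  | bob (msg : Y → Bool) (next : Bool → Protocol X Y) : Protocol X Y

namespace Protocol

variable {X Y : Type}

/-- The output of the protocol on the input `x` of Alice and the input `y` of Bob. -/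
def run : Protocol X Y → X → Y → Bool
  | output r, _, _ => r
  | alice msg next, x, y => (next (msg x)).run x y
  | bob msg next, x, y => (next (msg y)).run x y

/-- The number of bits that Alice sends on the inputs `x`, `y`. -/
def aliceBits : Protocol X Y → X → Y → ℕ
  | output _, _, _ => 0
  | alice msg next, x, y => (next (msg x)).aliceBits x y + 1
  | bob msg next, x, y => (next (msg y)).aliceBits x y

/-- The number of bits that Bob sends on the inputs `x`, `y`. -/
def bobBits : Protocol X Y → X → Y → ℕ
  | output _, _, _ => 0
  | alice msg next, x, y => (next (msg x)).bobBits x y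
  | bob msg next, x, y => (next (msg y)).bobBits x y + 1

end Protocol

/-- A randomized (public-coin) protocol: a probability distribution on deterministic protocols.
Private coins are a special case, since the two players may use separate parts of the
public randomness. -/
abbrev RandomizedProtocol (X Y : Type) : Type := PMF (Protocol X Y)

/-- On every pair of inputs, the protocol errs with probability at most `η`. -/
def RandomizedProtocol.Solves {X Y : Type} (P : RandomizedProtocol X Y) (f : X → Y → Prop)
    (η : ℝ≥0∞) : Prop :=
  ∀ x y, P.toOuterMeasure {π | ¬ (π.run x y = true ↔ f x y)} ≤ η

/-- In every execution, Alice sends at most `a` bits. -/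
def RandomizedProtocol.AliceSendsAtMost {X Y : Type} (P : RandomizedProtocol X Y) (a : ℕ) : Prop :=
  ∀ π ∈ P.support, ∀ x y, π.aliceBits x y ≤ a

/-- In every execution, Bob sends at most `b` bits. -/
def RandomizedProtocol.BobSendsAtMost {X Y : Type} (P : RandomizedProtocol X Y) (b : ℕ) : Prop :=
  ∀ π ∈ P.support, ∀ x y, π.bobBits x y ≤ b

/-- A memory of `S` cells of `w` bits each. -/
abbrev Memory (S w : ℕ) : Type := Fin S → (Fin w → Bool)

/-- An adaptive cell-probe query algorithm (for one fixed query): it either stops with an answer or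
probes a cell and continues depending on the contents of that cell. -/
inductive ProbeTree (S w : ℕ) : Type
  | answer (r : Bool) : ProbeTree S w
  | probe (i : Fin S) (next : (Fin w → Bool) → ProbeTree S w) : ProbeTree S w

namespace ProbeTree

variable {S w : ℕ}

/-- The answer of the algorithm on the memory `m`. -/
def run : ProbeTree S w → Memory S w → Bool
  | answer r, _ => r
  | probe i next, m => (next (m i)).run m

/-- The number of cells probed on the memory `m`. -/
def probes : ProbeTree S w → Memory S w → ℕ
  | answer _, _ => 0
  | probe i next, m => (next (m i)).probes m + 1

end ProbeTree

/-- A static cell-probe data structure with `S` cells of `w` bits, for queries in `X` and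
databases in `Y`: the memory representation of each database and the query algorithm. -/
structure CellProbe (X Y : Type) (S w : ℕ) : Type where
  encode : Y → Memory S w
  query : X → ProbeTree S w

/-- A randomized data structure: a probability distribution on deterministic ones (the coins are
available both when the database is stored and when a query is answered). A deterministic data
structure is the special case of a point mass. -/
abbrev RandomizedCellProbe (X Y : Type) (S w : ℕ) : Type := PMF (CellProbe X Y S w)

/-- On every query and database, the answer is wrong with probability at most `η`. -/
def RandomizedCellProbe.Solves {X Y : Type} {S w : ℕ} (P : RandomizedCellProbe X Y S w)
    (f : X → Y → Prop) (η : ℝ≥0∞) : Prop :=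
  ∀ x y, P.toOuterMeasure {A | ¬ ((A.query x).run (A.encode y) = true ↔ f x y)} ≤ η

/-- Every query on every database is answered with at most `t` probes. -/
def RandomizedCellProbe.HasQueryTime {X Y : Type} {S w : ℕ} (P : RandomizedCellProbe X Y S w)
    (t : ℕ) : Prop :=
  ∀ A ∈ P.support, ∀ x y, (A.query x).probes (A.encode y) ≤ t

/-! Partial match is bounded below through lopsided set disjointness: Alice holds one point in each
of `k` blocks of size `B = 2 ^ ℓ`, Bob holds a subset of each block, and the question is whether
some point lies in its set.

The engine is a corruption bound in entropy form (`Corruption`): a rectangle cannot carry much mass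
of disjoint pairs without carrying a comparable mass of intersecting pairs, unless one of its sides
has large relative entropy. For one block (`corruption_block`) this is concentration. If Alice's
weight is not carried by heavy points, then by Hoeffding's inequality almost every set contains
about half of it; Gibbs' inequality charges heavy points to Alice's entropy and exceptional sets to
Bob's. The bound tensorizes (`Corruption.prod`), because the chain rule splits both entropies along
the same slices. For `k` blocks the comparison is between disjoint pairs and pairs that meet in
exactly one block.

The transcripts of a protocol partition the input pairs into rectangles. If Alice sends `a` bits,
their total entropy on her side is at most about `a + k` times the mass of the disjoint pairs
(`sum_condEnt_le`), and similarly for Bob. Averaging over a hard distribution then gives `a ≥ c k ℓ`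
or `b ≥ c k B ^ (1 - ε)` (`lopsidedDisjointness_lower_bound`).

Three reductions, for `d` at least `n ^ (1 - ε)`, for `d` close to `log n`, and for `d` in between,
transfer this to partial match. The data structure bound follows by letting Alice send cell names
and Bob cell contents (`simulate`). -/

/-! ### Weighted rectangles, conditional relative entropy, and tensorization. -/

/-- The mass that the product weight `x ⊗ y` gives to the weight `d`. -/
noncomputable def mass {S T : Type*} [Fintype S] [Fintype T] (d : S → T → ℝ)
    (x : S → ℝ) (y : T → ℝ) : ℝ :=
  ∑ s, ∑ t, d s t * x s * y t

/-- The conditional relative entropy of the first coordinate, given the second, with respect to a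
uniform distribution on `N` points, for the measure with density `x ⊗ y` with respect to `d`. -/
noncomputable def condEnt {S T : Type*} [Fintype S] [Fintype T] (d : S → T → ℝ) (N : ℝ)
    (x : S → ℝ) (y : T → ℝ) : ℝ :=
  ∑ t, y t * ∑ s, d s t * x s * Real.log (N * x s / ∑ s', d s' t * x s')

/-- The weight `e` has almost the mass of `κ • d` on every rectangle on which neither coordinate
has large conditional relative entropy under `d`. -/
def Corruption {S T : Type*} [Fintype S] [Fintype T] (d e : S → T → ℝ) (M N κ α β : ℝ) : Prop :=
  ∀ (x : S → ℝ) (y : T → ℝ), (∀ s, 0 ≤ x s) → (∀ t, 0 ≤ y t) →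
    κ * mass d x y - α * condEnt d M x y - β * condEnt (fun t s => d s t) N y x ≤ mass e x y

section Product

variable {S₁ S₂ T₁ T₂ : Type*} [Fintype S₁] [Fintype S₂] [Fintype T₁] [Fintype T₂]

/-- Slicing at a fixed first coordinate of Alice averages Bob's first coordinate against `d`, so
slices of 0/1 rectangles have real weights. This is why `Corruption` quantifies over all nonnegative
weights. -/
theorem mass_prod_eq_sum_left (d : S₁ → T₁ → ℝ) (e : S₂ → T₂ → ℝ)
    (x : S₁ × S₂ → ℝ) (y : T₁ × T₂ → ℝ) :
    mass (fun s t => d s.1 t.1 * e s.2 t.2) x y =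
      ∑ s₁, mass e (fun s₂ => x (s₁, s₂)) (fun t₂ => ∑ t₁, d s₁ t₁ * y (t₁, t₂)) := by
  simp only [mass, Fintype.sum_prod_type]
  refine Finset.sum_congr rfl fun s₁ _ => Finset.sum_congr rfl fun s₂ _ => ?_
  rw [Finset.sum_comm]
  refine Finset.sum_congr rfl fun t₂ _ => ?_
  rw [Finset.mul_sum]
  exact Finset.sum_congr rfl fun t₁ _ => by ring

theorem mass_prod_eq_sum_right (d : S₁ → T₁ → ℝ) (e : S₂ → T₂ → ℝ)
    (x : S₁ × S₂ → ℝ) (y : T₁ × T₂ → ℝ) :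
    mass (fun s t => d s.1 t.1 * e s.2 t.2) x y =
      ∑ t₂, mass d (fun s₁ => ∑ s₂, e s₂ t₂ * x (s₁, s₂)) (fun t₁ => y (t₁, t₂)) := by
  simp only [mass, Fintype.sum_prod_type]
  rw [Finset.sum_comm' (t' := Finset.univ) (s' := fun _ => Finset.univ) (by simp)]
  simp only [Finset.mul_sum, Finset.sum_mul]
  rw [Finset.sum_comm]
  calc _ = ∑ s₁, ∑ t₂, ∑ t₁, ∑ s₂, d s₁ t₁ * e s₂ t₂ * x (s₁, s₂) * y (t₁, t₂) := by
        refine Finset.sum_congr rfl fun s₁ _ => ?_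
        rw [Finset.sum_congr rfl fun s₂ _ => Finset.sum_comm, Finset.sum_comm]
        exact Finset.sum_congr rfl fun t₂ _ => Finset.sum_comm
    _ = _ := by
        rw [Finset.sum_comm]
        refine Finset.sum_congr rfl fun t₂ _ => Finset.sum_congr rfl fun s₁ _ =>
          Finset.sum_congr rfl fun t₁ _ => Finset.sum_congr rfl fun s₂ _ => by ring

/-- The chain rule. -/
theorem condEnt_prod (d : S₁ → T₁ → ℝ) (e : S₂ → T₂ → ℝ) {M N : ℝ} (hM : 0 < M) (hN : 0 < N)
    (hd : ∀ s t, 0 ≤ d s t) (he : ∀ s t, 0 ≤ e s t)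
    (x : S₁ × S₂ → ℝ) (y : T₁ × T₂ → ℝ) (hx : ∀ s, 0 ≤ x s) :
    condEnt (fun s t => d s.1 t.1 * e s.2 t.2) (M * N) x y =
      ∑ s₁, condEnt e N (fun s₂ => x (s₁, s₂)) (fun t₂ => ∑ t₁, d s₁ t₁ * y (t₁, t₂)) +
      ∑ t₂, condEnt d M (fun s₁ => ∑ s₂, e s₂ t₂ * x (s₁, s₂)) (fun t₁ => y (t₁, t₂)) := by
  -- Insert the inner sum over `s₂'` between numerator and denominator: the logarithm of the product
  -- splits into the part for `s₂` given `s₁` and the part for `s₁`. Where the weight vanishes both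
  -- sides are zero; elsewhere all arguments of the logarithms are positive.
  have key : ∀ s₁ s₂ t₁ t₂, d s₁ t₁ * e s₂ t₂ * x (s₁, s₂) *
      Real.log (M * N * x (s₁, s₂) / ∑ s₁', ∑ s₂', d s₁' t₁ * e s₂' t₂ * x (s₁', s₂')) =
      d s₁ t₁ * (e s₂ t₂ * x (s₁, s₂) *
        Real.log (N * x (s₁, s₂) / ∑ s₂', e s₂' t₂ * x (s₁, s₂'))) +
      d s₁ t₁ * (e s₂ t₂ * x (s₁, s₂)) * Real.log (M * (∑ s₂', e s₂' t₂ * x (s₁, s₂')) /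
        ∑ s₁', d s₁' t₁ * ∑ s₂', e s₂' t₂ * x (s₁', s₂')) := by
    intro s₁ s₂ t₁ t₂
    have hsum : ∑ s₁', ∑ s₂', d s₁' t₁ * e s₂' t₂ * x (s₁', s₂') =
        ∑ s₁', d s₁' t₁ * ∑ s₂', e s₂' t₂ * x (s₁', s₂') := by
      refine Finset.sum_congr rfl fun s₁' _ => ?_
      rw [Finset.mul_sum]
      exact Finset.sum_congr rfl fun s₂' _ => by ring
    rw [hsum]
    have hnn : ∀ s₁', 0 ≤ ∑ s₂', e s₂' t₂ * x (s₁', s₂') := fun s₁' =>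
      Finset.sum_nonneg fun s₂' _ => mul_nonneg (he _ _) (hx _)
    by_cases h0 : d s₁ t₁ * (e s₂ t₂ * x (s₁, s₂)) = 0
    · rw [mul_assoc (d s₁ t₁), h0, ← mul_assoc (d s₁ t₁), h0]; simp
    have hd0 : 0 < d s₁ t₁ := lt_of_le_of_ne (hd _ _) fun h => h0 (by rw [← h, zero_mul])
    have hex : 0 < e s₂ t₂ * x (s₁, s₂) :=
      lt_of_le_of_ne (mul_nonneg (he _ _) (hx _)) fun h => h0 (by rw [← h, mul_zero])
    have hx0 : 0 < x (s₁, s₂) :=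
      lt_of_le_of_ne (hx _) fun h => hex.ne' (by rw [← h, mul_zero])
    have h1 : 0 < ∑ s₂', e s₂' t₂ * x (s₁, s₂') := hex.trans_le
      (Finset.single_le_sum (f := fun s₂' => e s₂' t₂ * x (s₁, s₂'))
        (fun s₂' _ => mul_nonneg (he _ _) (hx _)) (Finset.mem_univ s₂))
    have h2 : 0 < ∑ s₁', d s₁' t₁ * ∑ s₂', e s₂' t₂ * x (s₁', s₂') := (mul_pos hd0 h1).trans_le
      (Finset.single_le_sum (f := fun s₁' => d s₁' t₁ * ∑ s₂', e s₂' t₂ * x (s₁', s₂'))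
        (fun s₁' _ => mul_nonneg (hd _ _) (hnn _)) (Finset.mem_univ s₁))
    rw [Real.log_div (by positivity) h2.ne', Real.log_div (by positivity) h1.ne',
      Real.log_div (by positivity) h2.ne', Real.log_mul (by positivity) hx0.ne',
      Real.log_mul hM.ne' hN.ne', Real.log_mul hN.ne' hx0.ne', Real.log_mul hM.ne' h1.ne']
    ring
  have hl : condEnt (fun s t => d s.1 t.1 * e s.2 t.2) (M * N) x y =
      ∑ t₁, ∑ t₂, ∑ s₁, ∑ s₂, y (t₁, t₂) * (d s₁ t₁ * (e s₂ t₂ * x (s₁, s₂) *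
        Real.log (N * x (s₁, s₂) / ∑ s₂', e s₂' t₂ * x (s₁, s₂')))) +
      ∑ t₁, ∑ t₂, ∑ s₁, ∑ s₂, y (t₁, t₂) * (d s₁ t₁ * (e s₂ t₂ * x (s₁, s₂)) *
        Real.log (M * (∑ s₂', e s₂' t₂ * x (s₁, s₂')) /
        ∑ s₁', d s₁' t₁ * ∑ s₂', e s₂' t₂ * x (s₁', s₂'))) := by
    simp only [condEnt, Fintype.sum_prod_type, key, Finset.sum_add_distrib, Finset.mul_sum,
      mul_add]
  rw [hl]
  congr 1
  · simp only [condEnt, Finset.mul_sum, Finset.sum_mul]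
    calc _ = ∑ s₁, ∑ t₁, ∑ t₂, ∑ s₂, y (t₁, t₂) * (d s₁ t₁ * (e s₂ t₂ * x (s₁, s₂) *
        Real.log (N * x (s₁, s₂) / ∑ s₂', e s₂' t₂ * x (s₁, s₂')))) := by
          rw [Finset.sum_congr rfl fun t₁ _ => Finset.sum_comm, Finset.sum_comm]
      _ = _ := by
          refine Finset.sum_congr rfl fun s₁ _ => ?_
          rw [Finset.sum_comm]
          refine Finset.sum_congr rfl fun t₂ _ => ?_
          rw [Finset.sum_comm]
          exact Finset.sum_congr rfl fun s₂ _ => Finset.sum_congr rfl fun t₁ _ => by ring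
  · rw [Finset.sum_comm]
    refine Finset.sum_congr rfl fun t₂ _ => Finset.sum_congr rfl fun t₁ _ => ?_
    rw [Finset.mul_sum]
    refine Finset.sum_congr rfl fun s₁ _ => ?_
    rw [← Finset.mul_sum, ← Finset.sum_mul, ← Finset.mul_sum]

/-- The chain rule for the other player, with the same decomposition as in `condEnt_prod`. -/
theorem condEnt_swap_prod (d : S₁ → T₁ → ℝ) (e : S₂ → T₂ → ℝ) {M N : ℝ} (hM : 0 < M) (hN : 0 < N)
    (hd : ∀ s t, 0 ≤ d s t) (he : ∀ s t, 0 ≤ e s t)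
    (x : S₁ × S₂ → ℝ) (y : T₁ × T₂ → ℝ) (hy : ∀ s, 0 ≤ y s) :
    condEnt (fun t s => d s.1 t.1 * e s.2 t.2) (M * N) y x =
      ∑ s₁, condEnt (fun t s => e s t) N (fun t₂ => ∑ t₁, d s₁ t₁ * y (t₁, t₂))
        (fun s₂ => x (s₁, s₂)) +
      ∑ t₂, condEnt (fun t s => d s t) M (fun t₁ => y (t₁, t₂))
        (fun s₁ => ∑ s₂, e s₂ t₂ * x (s₁, s₂)) := by
  -- The chain rule is applied with the two coordinates in reverse order, which produces exactly the
  -- slices that Alice's chain rule produces.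
  have h := condEnt_prod (fun t s => e s t) (fun t s => d s t) hN hM (fun _ _ => he _ _)
    (fun _ _ => hd _ _) (fun t => y t.swap) (fun s => x s.swap) (fun s => hy _)
  rw [add_comm]
  refine Eq.trans ?_ h
  unfold condEnt
  rw [← (Equiv.prodComm S₂ S₁).sum_comp]
  refine Finset.sum_congr rfl fun s _ => ?_
  rw [← (Equiv.prodComm T₂ T₁).sum_comp]
  have : ∀ s : S₂ × S₁, ∑ t : T₁ × T₂, d s.2 t.1 * e s.1 t.2 * y t =
      ∑ t : T₂ × T₁, e s.1 t.1 * d s.2 t.2 * y t.swap := by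
    intro s
    rw [← (Equiv.prodComm T₂ T₁).sum_comp]
    exact Finset.sum_congr rfl fun t _ => by simp [mul_comm (d _ _)]
  simp only [Equiv.prodComm_apply, Prod.fst_swap, Prod.snd_swap, this, mul_comm M N]
  congr 1
  exact Finset.sum_congr rfl fun t _ => by rw [mul_comm (d _ _)]

/-- `h₁` is applied to the slices with `t₂` fixed and `h₂` to those with `s₁` fixed. Summed over the
slices, the masses recombine to the mass of the product and the entropies add up by the two chain
rules. -/
theorem Corruption.prod {d₁ e₁ : S₁ → T₁ → ℝ} {d₂ e₂ : S₂ → T₂ → ℝ}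
    {M₁ N₁ M₂ N₂ κ₁ κ₂ α β : ℝ} (hM₁ : 0 < M₁) (hN₁ : 0 < N₁) (hM₂ : 0 < M₂) (hN₂ : 0 < N₂)
    (hd₁ : ∀ s t, 0 ≤ d₁ s t) (hd₂ : ∀ s t, 0 ≤ d₂ s t)
    (h₁ : Corruption d₁ e₁ M₁ N₁ κ₁ α β) (h₂ : Corruption d₂ e₂ M₂ N₂ κ₂ α β) :
    Corruption (fun (s : S₁ × S₂) (t : T₁ × T₂) => d₁ s.1 t.1 * d₂ s.2 t.2)
      (fun s t => e₁ s.1 t.1 * d₂ s.2 t.2 + d₁ s.1 t.1 * e₂ s.2 t.2)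
      (M₁ * M₂) (N₁ * N₂) (κ₁ + κ₂) α β := by
  intro x y hx hy
  have hadd : mass (fun (s : S₁ × S₂) (t : T₁ × T₂) =>
      e₁ s.1 t.1 * d₂ s.2 t.2 + d₁ s.1 t.1 * e₂ s.2 t.2) x y =
      mass (fun s t => e₁ s.1 t.1 * d₂ s.2 t.2) x y +
      mass (fun s t => d₁ s.1 t.1 * e₂ s.2 t.2) x y := by
    simp only [mass, add_mul, Finset.sum_add_distrib]
  have b₁ := Finset.sum_le_sum fun t₂ (_ : t₂ ∈ Finset.univ) =>
    h₁ (fun s₁ => ∑ s₂, d₂ s₂ t₂ * x (s₁, s₂)) (fun t₁ => y (t₁, t₂))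
      (fun s₁ => Finset.sum_nonneg fun s₂ _ => mul_nonneg (hd₂ _ _) (hx _)) (fun t₁ => hy _)
  have b₂ := Finset.sum_le_sum fun s₁ (_ : s₁ ∈ Finset.univ) =>
    h₂ (fun s₂ => x (s₁, s₂)) (fun t₂ => ∑ t₁, d₁ s₁ t₁ * y (t₁, t₂)) (fun s₂ => hx _)
      (fun t₂ => Finset.sum_nonneg fun t₁ _ => mul_nonneg (hd₁ _ _) (hy _))
  simp only [Finset.sum_sub_distrib, ← Finset.mul_sum] at b₁ b₂
  rw [hadd, condEnt_prod d₁ d₂ hM₁ hM₂ hd₁ hd₂ x y hx,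
    condEnt_swap_prod d₁ d₂ hN₁ hN₂ hd₁ hd₂ x y hy,
    mass_prod_eq_sum_right e₁, mass_prod_eq_sum_left d₁ e₂, add_mul]
  rw [← mass_prod_eq_sum_right] at b₁
  rw [← mass_prod_eq_sum_left] at b₂
  linarith

theorem Corruption.congr_equiv {d e : S₁ → T₁ → ℝ} {M N κ α β : ℝ} (h : Corruption d e M N κ α β)
    (f : S₂ ≃ S₁) (g : T₂ ≃ T₁) :
    Corruption (fun s t => d (f s) (g t)) (fun s t => e (f s) (g t)) M N κ α β := by
  intro x y hx hy
  have := h (fun s => x (f.symm s)) (fun t => y (g.symm t)) (fun _ => hx _) (fun _ => hy _)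
  simp only [mass, condEnt] at this
  rw [← f.sum_comp, ← g.sum_comp, ← f.sum_comp, ← f.sum_comp] at this
  simp only [← f.sum_comp (fun s => _ * _), ← g.sum_comp (fun s => _ * _),
    Equiv.symm_apply_apply] at this
  exact this

end Product

/-! ### Entropy bounds from test functions. -/

/-- Gibbs' inequality. -/
theorem sum_mul_log_ge {ι : Type*} [Fintype ι] (q h : ι → ℝ) (hq : ∀ i, 0 ≤ q i) {N : ℝ}
    (hN : 0 < N) :
    ∑ i, q i * h i - (∑ i, q i) * ((∑ i, Real.exp (h i)) / N - 1) ≤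
      ∑ i, q i * Real.log (N * q i / ∑ j, q j) := by
  set Q := ∑ j, q j with hQ
  have hQ0 : 0 ≤ Q := Finset.sum_nonneg fun i _ => hq i
  -- This is `log u ≤ u - 1` at `u = Q * exp (h i) / (N * q i)`.
  have key : ∀ i, q i * h i + (q i - Q * Real.exp (h i) / N) ≤ q i * Real.log (N * q i / Q) := by
    intro i
    rcases (hq i).eq_or_lt with h0 | hpos
    · rw [← h0]
      have : 0 ≤ Q * Real.exp (h i) / N := by positivity
      simp only [zero_mul]; linarith
    have hQp : 0 < Q := hpos.trans_le
      (Finset.single_le_sum (f := q) (fun j _ => hq j) (Finset.mem_univ i))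
    have h1 := Real.log_le_sub_one_of_pos (x := Q * Real.exp (h i) / (N * q i)) (by positivity)
    have h2 : Real.log (Q * Real.exp (h i) / (N * q i)) = h i - Real.log (N * q i / Q) := by
      rw [Real.log_div (by positivity) (by positivity), Real.log_div (by positivity) hQp.ne',
        Real.log_mul hQp.ne' (Real.exp_ne_zero _), Real.log_exp]
      ring
    rw [h2] at h1
    have h3 := mul_le_mul_of_nonneg_left h1 hpos.le
    have h4 : q i * (Q * Real.exp (h i) / (N * q i) - 1) = Q * Real.exp (h i) / N - q i := by
      field_simp
    rw [h4] at h3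
    linarith
  have := Finset.sum_le_sum fun i (_ : i ∈ Finset.univ) => key i
  simp only [Finset.sum_add_distrib, Finset.sum_sub_distrib, ← Finset.sum_div,
    ← Finset.mul_sum] at this
  rw [← hQ] at this
  calc _ = ∑ i, q i * h i + (Q - Q * (∑ i, Real.exp (h i)) / N) := by ring
    _ ≤ _ := this

/-- Gibbs' inequality on each column. A test function equal to `λ` on a rare event and zero
elsewhere shows that the mass of that event is at most `(condEnt + mass) / λ`; the factor 2 in `hh`
leaves room for the exponential on the event. -/
theorem condEnt_ge {S T : Type*} [Fintype S] [Fintype T] (d : S → T → ℝ)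
    (hd : ∀ s t, d s t = 0 ∨ d s t = 1) {N : ℝ} (hN : 0 < N) (x : S → ℝ) (y : T → ℝ)
    (hx : ∀ s, 0 ≤ x s) (hy : ∀ t, 0 ≤ y t) (h : S → T → ℝ)
    (hh : ∀ t, ∑ s, Real.exp (h s t) ≤ 2 * N) :
    ∑ t, y t * ∑ s, d s t * x s * h s t - mass d x y ≤ condEnt d N x y := by
  have hmass : mass d x y = ∑ t, y t * ∑ s, d s t * x s := by
    unfold mass
    rw [Finset.sum_comm]
    exact Finset.sum_congr rfl fun t _ => by rw [mul_comm, Finset.sum_mul]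
  rw [hmass, ← Finset.sum_sub_distrib]
  refine Finset.sum_le_sum fun t _ => ?_
  rw [← mul_sub]
  refine mul_le_mul_of_nonneg_left ?_ (hy t)
  have hq : ∀ s, 0 ≤ d s t * x s := fun s => by
    rcases hd s t with h | h <;> simp [h, hx s]
  have g := sum_mul_log_ge (fun s => d s t * x s) (fun s => h s t) hq hN
  have e : ∀ s, d s t * x s * Real.log (N * (d s t * x s) / ∑ s', d s' t * x s') =
      d s t * x s * Real.log (N * x s / ∑ s', d s' t * x s') := fun s => by
    rcases hd s t with h | h <;> simp [h]
  simp only [e] at g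
  have h2 : (∑ s, Real.exp (h s t)) / N - 1 ≤ 1 := by
    have := (div_le_iff₀ hN).2 (hh t); linarith
  have h3 := mul_le_mul_of_nonneg_left h2 (Finset.sum_nonneg fun s (_ : s ∈ Finset.univ) => hq s)
  linarith

/-! ### One block: a point against a random set. -/

/-- The indicator that the point `s` lies outside of the set `T`. -/
def avoid {A : Type*} (s : A) (T : A → Bool) : ℝ := if T s then 0 else 1

/-- The indicator that the point `s` lies in the set `T`. -/
def hit {A : Type*} (s : A) (T : A → Bool) : ℝ := if T s then 1 else 0

theorem avoid_eq {A : Type*} (s : A) (T : A → Bool) : avoid s T = 0 ∨ avoid s T = 1 := by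
  unfold avoid; split <;> simp

section Block

variable {A : Type*} [Fintype A] [DecidableEq A]

/-- Hoeffding's inequality for sums of independent random signs. -/
theorem card_signed_sum_ge_le (x : A → ℝ) {δ V : ℝ} (hδ : 0 ≤ δ) (hV : 0 < V)
    (hxV : ∑ s, x s ^ 2 ≤ V) :
    ((Finset.univ.filter fun T : A → Bool => δ ≤ ∑ s, x s * (if T s then -1 else 1)).card : ℝ) ≤
      2 ^ Fintype.card A * Real.exp (-(δ ^ 2 / (2 * V))) := by
  -- The minimizer of the Chernoff exponent `r ^ 2 * V / 2 - r * δ`.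
  set r := δ / V with hr
  have hr0 : 0 ≤ r := by positivity
  have h1 : ∑ T : A → Bool, Real.exp (r * ∑ s, x s * (if T s then -1 else 1)) =
      ∏ s, (2 * Real.cosh (r * x s)) := by
    have : ∀ s, 2 * Real.cosh (r * x s) =
        ∑ b : Bool, Real.exp (r * (x s * (if b then -1 else 1))) := by
      intro s
      rw [Real.cosh_eq]
      simp
      ring
    simp only [this]
    rw [Finset.prod_univ_sum, Fintype.piFinset_univ]
    refine Finset.sum_congr rfl fun T _ => ?_
    rw [Finset.mul_sum, Real.exp_sum]
  have h2 : ∏ s, (2 * Real.cosh (r * x s)) ≤ 2 ^ Fintype.card A * Real.exp (r ^ 2 * V / 2) := by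
    rw [Finset.prod_mul_distrib, Finset.prod_const, Finset.card_univ]
    refine mul_le_mul_of_nonneg_left ?_ (by positivity)
    calc ∏ s, Real.cosh (r * x s) ≤ ∏ s, Real.exp ((r * x s) ^ 2 / 2) :=
          Finset.prod_le_prod (fun s _ => (Real.cosh_pos _).le)
            fun s _ => Real.cosh_le_exp_half_sq _
      _ = Real.exp (r ^ 2 * (∑ s, x s ^ 2) / 2) := by
          rw [← Real.exp_sum, Finset.mul_sum, Finset.sum_div]
          exact congrArg _ (Finset.sum_congr rfl fun s _ => by ring)
      _ ≤ _ := by gcongr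
  have h3 : ((Finset.univ.filter fun T : A → Bool =>
      δ ≤ ∑ s, x s * (if T s then -1 else 1)).card : ℝ) * Real.exp (r * δ) ≤
      ∑ T : A → Bool, Real.exp (r * ∑ s, x s * (if T s then -1 else 1)) := by
    rw [← nsmul_eq_mul, ← Finset.sum_const]
    refine (Finset.sum_le_sum fun T hT => ?_).trans
      (Finset.sum_le_sum_of_subset_of_nonneg (Finset.filter_subset _ _)
        fun _ _ _ => (Real.exp_pos _).le)
    rw [Finset.mem_filter] at hT
    exact Real.exp_le_exp.2 (mul_le_mul_of_nonneg_left hT.2 hr0)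
  rw [h1] at h3
  have h4 := (le_div_iff₀ (Real.exp_pos _)).2 (h3.trans h2)
  refine h4.trans (le_of_eq ?_)
  rw [mul_div_assoc, ← Real.exp_sub]
  congr 2
  rw [hr]
  field_simp
  ring

/-- For all but few sets `T`, the weight of `T` is nearly as large as the weight that the
complement of `T` has outside of its heavy points. -/
theorem exists_exceptional_sets [Nonempty A] (x : A → ℝ) (hx : ∀ s, 0 ≤ x s) {γ K : ℝ} (hγ : 0 < γ)
    (hK : 0 < K) :
    ∃ E : Finset (A → Bool), (E.card : ℝ) ≤ Fintype.card A *
        (2 ^ Fintype.card A * Real.exp (-(γ ^ 2 * Fintype.card A / (4 * K)))) ∧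
      ∀ T ∉ E, (1 - γ) * ∑ s, avoid s T * x s - ∑ s, avoid s T * x s *
        (if T s = false ∧ K * ∑ s', avoid s' T * x s' < Fintype.card A * x s then 1 else 0) ≤
        ∑ s, hit s T * x s := by
  classical
  set B : ℝ := (Fintype.card A : ℝ) with hB
  have hB0 : 0 < B := by rw [hB]; exact_mod_cast Fintype.card_pos
  set x' : A → A → ℝ := fun s₀ s => if x s ≤ x s₀ then x s else 0 with hx'
  have hx'0 : ∀ s₀ s, 0 ≤ x' s₀ s := fun s₀ s => by simp only [hx']; split <;> simp [hx]
  have hx'x : ∀ s₀ s, x' s₀ s ≤ x s := fun s₀ s => by simp only [hx']; split <;> simp [hx]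
  have hx'm : ∀ s₀ s, x' s₀ s ≤ x s₀ := fun s₀ s => by
    simp only [hx']; split <;> simp [*]
  -- Both terms are lower bounds for the deviation that a bad `T` causes. Together they bound the
  -- variance `∑ x' ^ 2 ≤ x s₀ * ∑ x'` by `2 * δ ^ 2 * K / (γ ^ 2 * B)`, so that `δ` cancels in
  -- Hoeffding's exponent.
  set δ : A → ℝ := fun s₀ => max (γ * (∑ s, x' s₀ s) / 2) (γ * x s₀ * B / K) with hδ
  set F : A → Finset (A → Bool) := fun s₀ => if 0 < x s₀ then
    Finset.univ.filter fun T => δ s₀ ≤ ∑ s, x' s₀ s * (if T s then -1 else 1) else ∅ with hF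
  refine ⟨Finset.univ.biUnion F, ?_, ?_⟩
  · have h1 : ∀ s₀, ((F s₀).card : ℝ) ≤ 2 ^ Fintype.card A * Real.exp (-(γ ^ 2 * B / (4 * K))) := by
      intro s₀
      simp only [hF]
      split_ifs with h0
      · have hδ0 : 0 < δ s₀ := lt_max_of_lt_right (by positivity)
        have := card_signed_sum_ge_le (x' s₀) (δ := δ s₀) (V := 2 * δ s₀ ^ 2 * K / (γ ^ 2 * B))
          hδ0.le (by positivity) ?_
        · refine this.trans (le_of_eq ?_)
          congr 3
          field_simp
          ring
        · have hs : ∑ s, x' s₀ s ^ 2 ≤ x s₀ * ∑ s, x' s₀ s := by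
            rw [Finset.mul_sum]
            refine Finset.sum_le_sum fun s _ => ?_
            rw [sq]
            exact mul_le_mul_of_nonneg_right (hx'm _ _) (hx'0 _ _)
          refine hs.trans ?_
          have a1 : ∑ s, x' s₀ s ≤ 2 * δ s₀ / γ := by
            rw [le_div_iff₀ hγ]
            have : γ * (∑ s, x' s₀ s) / 2 ≤ δ s₀ := le_max_left _ _
            linarith
          have a2 : x s₀ ≤ δ s₀ * K / (γ * B) := by
            rw [le_div_iff₀ (by positivity)]
            have : γ * x s₀ * B / K ≤ δ s₀ := le_max_right _ _
            rw [div_le_iff₀ hK] at this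
            linarith
          calc x s₀ * ∑ s, x' s₀ s ≤ (δ s₀ * K / (γ * B)) * (2 * δ s₀ / γ) :=
                mul_le_mul a2 a1 (Finset.sum_nonneg fun s _ => hx'0 _ _) (by positivity)
            _ = _ := by field_simp
      · simp; positivity
    have h2 : ((Finset.univ.biUnion F).card : ℝ) ≤ ∑ s₀, ((F s₀).card : ℝ) := by
      exact_mod_cast Finset.card_biUnion_le
    refine h2.trans ((Finset.sum_le_sum fun s₀ _ => h1 s₀).trans (le_of_eq ?_))
    rw [Finset.sum_const, Finset.card_univ, nsmul_eq_mul]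
  · intro T hT
    set X := ∑ s, avoid s T * x s with hX
    have hX0 : 0 ≤ X := Finset.sum_nonneg fun s _ => by
      unfold avoid; split <;> simp [hx]
    have hhit0 : ∀ z : A → ℝ, (∀ s, 0 ≤ z s) → 0 ≤ ∑ s, hit s T * z s := fun z hz =>
      Finset.sum_nonneg fun s _ => by unfold hit; split <;> simp [hz]
    by_contra! hlt
    set light := Finset.univ.filter fun s => B * x s ≤ K * X with hlight
    have hav : X - ∑ s, avoid s T * x s * (if T s = false ∧ K * X < B * x s then 1 else 0) =
        ∑ s ∈ light, avoid s T * x s := by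
      nth_rewrite 1 [hX]
      rw [← Finset.sum_sub_distrib, hlight, Finset.sum_filter]
      refine Finset.sum_congr rfl fun s _ => ?_
      unfold avoid
      by_cases h1 : T s = true <;> by_cases h2 : B * x s ≤ K * X
      · simp [h1]
      · simp [h1]
      · simp [h1, h2, not_lt.2 h2]
      · simp [h1, h2, not_le.1 h2]
    have hgap : ∑ s, hit s T * x s < ∑ s ∈ light, avoid s T * x s - γ * X := by
      rw [← hav]; linarith
    have hne : light.Nonempty := by
      by_contra h
      rw [Finset.not_nonempty_iff_eq_empty] at h
      rw [h, Finset.sum_empty] at hgap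
      have := hhit0 x hx
      nlinarith [mul_nonneg hγ.le hX0]
    -- The heaviest light point serves as the truncation level; the signed sum of the truncation
    -- exceeds `γ * X`, which puts `T` into `F s₀`.
    obtain ⟨s₀, hs₀, hmax⟩ := Finset.exists_max_image light x hne
    have hl : ∀ s, s ∈ light ↔ x s ≤ x s₀ := by
      intro s
      refine ⟨hmax s, fun h => ?_⟩
      rw [hlight, Finset.mem_filter] at hs₀ ⊢
      exact ⟨Finset.mem_univ _, (mul_le_mul_of_nonneg_left h hB0.le).trans hs₀.2⟩
    have hav' : ∑ s ∈ light, avoid s T * x s = ∑ s, avoid s T * x' s₀ s := by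
      rw [← Finset.sum_filter_add_sum_filter_not Finset.univ (fun s => x s ≤ x s₀)
        (fun s => avoid s T * x' s₀ s)]
      have h0 : ∑ s with ¬ x s ≤ x s₀, avoid s T * x' s₀ s = 0 :=
        Finset.sum_eq_zero fun s hs => by
          rw [Finset.mem_filter] at hs; simp [hx', hs.2]
      rw [h0, add_zero]
      refine Finset.sum_congr ?_ fun s hs => ?_
      · ext s; simp [hl]
      · rw [Finset.mem_filter] at hs; simp [hx', hs.2]
    have hhit' : ∑ s, hit s T * x' s₀ s ≤ ∑ s, hit s T * x s :=
      Finset.sum_le_sum fun s _ => mul_le_mul_of_nonneg_left (hx'x _ _)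
        (by unfold hit; split <;> simp)
    have hsum : ∑ s, x' s₀ s = ∑ s, avoid s T * x' s₀ s + ∑ s, hit s T * x' s₀ s := by
      rw [← Finset.sum_add_distrib]
      refine Finset.sum_congr rfl fun s _ => ?_
      unfold avoid hit; split <;> simp
    have hdiff : ∑ s, x' s₀ s * (if T s then -1 else 1) =
        ∑ s, avoid s T * x' s₀ s - ∑ s, hit s T * x' s₀ s := by
      rw [← Finset.sum_sub_distrib]
      refine Finset.sum_congr rfl fun s _ => ?_
      unfold avoid hit; split <;> simp
    have hle : ∑ s, avoid s T * x' s₀ s ≤ X :=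
      Finset.sum_le_sum fun s _ => mul_le_mul_of_nonneg_left (hx'x _ _)
        (by unfold avoid; split <;> simp)
    have hg : γ * X < ∑ s, x' s₀ s * (if T s then -1 else 1) := by
      rw [hdiff]; rw [hav'] at hgap; linarith
    have hhn := hhit0 (x' s₀) (hx'0 s₀)
    have hγX : 0 ≤ γ * X := by positivity
    have hx0 : 0 < x s₀ := by
      by_contra h
      have : ∀ s, x' s₀ s = 0 := fun s =>
        le_antisymm ((hx'm s₀ s).trans (not_lt.1 h)) (hx'0 s₀ s)
      simp only [this, zero_mul, Finset.sum_const_zero] at hg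
      linarith
    apply hT
    rw [Finset.mem_biUnion]
    refine ⟨s₀, Finset.mem_univ _, ?_⟩
    simp only [hF, if_pos hx0, Finset.mem_filter, Finset.mem_univ, true_and]
    refine max_le ?_ ?_
    · have : γ * ((∑ s, x' s₀ s) / 2) ≤ γ * X :=
        mul_le_mul_of_nonneg_left (by rw [hdiff] at hg; linarith) hγ.le
      linarith
    · rw [hlight, Finset.mem_filter] at hs₀
      rw [div_le_iff₀ hK]
      have := mul_le_mul_of_nonneg_left hs₀.2 hγ.le
      have h2 := mul_le_mul_of_nonneg_right hg.le hK.le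
      linarith

/-- Outside the exceptional sets the bound holds up to the mass of heavy points. That mass, `HA`, is
charged to Alice's entropy with a test function of height `log K`; the mass on exceptional sets,
`HB`, is charged to Bob's entropy with height `lam`. The hypothesis `hE` says that exceptional sets
are rare enough for this height. -/
theorem corruption_block [Nonempty A] {γ K lam : ℝ} (hγ : 0 < γ) (hK : 1 < K)
    (hlam : 0 < lam)
    (hE : Fintype.card A * Real.exp (-(γ ^ 2 * Fintype.card A / (4 * K))) * Real.exp lam ≤ 1) :
    Corruption (avoid (A := A)) hit (Fintype.card A) (2 ^ Fintype.card A)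
      (1 - γ - 1 / Real.log K - 1 / lam) (1 / Real.log K) (1 / lam) := by
  classical
  intro x y hx hy
  obtain ⟨E, hEc, hEx⟩ := exists_exceptional_sets x hx hγ (zero_lt_one.trans hK)
  set B : ℝ := (Fintype.card A : ℝ) with hB
  have hB0 : 0 < B := by rw [hB]; exact_mod_cast Fintype.card_pos
  have hK0 : 0 < K := zero_lt_one.trans hK
  have hlogK : 0 < Real.log K := Real.log_pos hK
  have hd0 : ∀ s (T : A → Bool), 0 ≤ avoid s T := fun s T => by unfold avoid; split <;> simp
  have hX0 : ∀ T, 0 ≤ ∑ s, avoid s T * x s := fun T =>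
    Finset.sum_nonneg fun s _ => mul_nonneg (hd0 _ _) (hx _)
  have entA := condEnt_ge avoid avoid_eq hB0 x y hx hy
    (fun s T => if T s = false ∧ K * ∑ s', avoid s' T * x s' < B * x s then Real.log K else 0)
    (by
      intro T
      set X := ∑ s', avoid s' T * x s' with hX
      have h1 : ∀ s, Real.exp (if T s = false ∧ K * X < B * x s then Real.log K else 0) ≤
          1 + (if T s = false ∧ K * X < B * x s then K else 0) := by
        intro s
        split_ifs
        · rw [Real.exp_log hK0]; linarith
        · simp
      refine (Finset.sum_le_sum fun s _ => h1 s).trans ?_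
      rw [Finset.sum_add_distrib, Finset.sum_const, Finset.card_univ, nsmul_eq_mul, mul_one,
        ← hB, two_mul]
      refine add_le_add le_rfl ?_
      rcases (hX0 T).eq_or_lt with h0 | hpos
      · rw [Finset.sum_eq_zero]
        · exact hB0.le
        intro s _
        rw [if_neg]
        rintro ⟨h1, h2⟩
        have := (Finset.sum_eq_zero_iff_of_nonneg
          (fun s _ => mul_nonneg (hd0 s T) (hx s))).1 h0.symm s (Finset.mem_univ s)
        simp only [avoid, h1, Bool.false_eq_true, if_false, one_mul] at this
        rw [this, hX, ← h0] at h2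
        simp at h2
      -- Markov's inequality: at most `B / K` points outside `T` are heavy.
      · have : ∀ s, (if T s = false ∧ K * X < B * x s then K else 0) ≤
            B / X * (avoid s T * x s) := by
          intro s
          split_ifs with h
          · rw [avoid, h.1]
            simp only [Bool.false_eq_true, if_false, one_mul]
            rw [div_mul_eq_mul_div, le_div_iff₀ hpos]
            exact h.2.le
          · have := mul_nonneg (hd0 s T) (hx s)
            positivity
        refine (Finset.sum_le_sum fun s _ => this s).trans ?_
        rw [← Finset.mul_sum, ← hX]
        exact (div_mul_cancel₀ _ hpos.ne').le)
  have entB := condEnt_ge (fun T (s : A) => avoid s T) (fun T s => avoid_eq s T)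
    (N := 2 ^ Fintype.card A) (by positivity) y x hy hx (fun T _ => if T ∈ E then lam else 0)
    (by
      intro _
      have h1 : ∀ T, Real.exp (if T ∈ E then lam else 0) ≤
          1 + (if T ∈ E then Real.exp lam else 0) := by
        intro T
        split_ifs
        · linarith
        · simp
      refine (Finset.sum_le_sum fun s _ => h1 s).trans ?_
      rw [Finset.sum_add_distrib, Finset.sum_const, Finset.card_univ, nsmul_eq_mul, mul_one,
        two_mul]
      refine add_le_add (by simp) ?_
      rw [Finset.sum_ite_mem, Finset.univ_inter, Finset.sum_const, nsmul_eq_mul]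
      calc (E.card : ℝ) * Real.exp lam
          ≤ B * (2 ^ Fintype.card A * Real.exp (-(γ ^ 2 * B / (4 * K)))) * Real.exp lam := by gcongr
        _ = 2 ^ Fintype.card A * (B * Real.exp (-(γ ^ 2 * B / (4 * K))) * Real.exp lam) := by ring
        _ ≤ 2 ^ Fintype.card A * 1 := by gcongr
        _ = _ := mul_one _)
  set W := mass avoid x y with hW
  have hswap : mass (fun T (s : A) => avoid s T) y x = W := by
    rw [hW, mass, mass, Finset.sum_comm]
    exact Finset.sum_congr rfl fun s _ => Finset.sum_congr rfl fun T _ => by ring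
  rw [hswap] at entB
  have hmass : ∀ d : A → (A → Bool) → ℝ, mass d x y = ∑ T, y T * ∑ s, d s T * x s := by
    intro d
    unfold mass
    rw [Finset.sum_comm]
    exact Finset.sum_congr rfl fun t _ => by rw [mul_comm, Finset.sum_mul]
  set HA := ∑ T, y T * ∑ s, avoid s T * x s *
    (if T s = false ∧ K * ∑ s', avoid s' T * x s' < B * x s then 1 else 0) with hHA
  set HB := ∑ T, y T * ∑ s, avoid s T * x s * (if T ∈ E then 1 else 0) with hHB
  have eA : ∑ T, y T * ∑ s, avoid s T * x s *
    (if T s = false ∧ K * ∑ s', avoid s' T * x s' < B * x s then Real.log K else 0) =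
      Real.log K * HA := by
    simp only [hHA, Finset.mul_sum]
    refine Finset.sum_congr rfl fun T _ => Finset.sum_congr rfl fun s _ => ?_
    split <;> ring
  have eB : ∑ s, x s * ∑ T, avoid s T * y T * (if T ∈ E then lam else 0) = lam * HB := by
    simp only [hHB, Finset.mul_sum]
    rw [Finset.sum_comm]
    refine Finset.sum_congr rfl fun T _ => Finset.sum_congr rfl fun s _ => ?_
    split <;> ring
  rw [eA] at entA
  rw [eB] at entB
  have main : (1 - γ) * W - HA - HB ≤ mass hit x y := by
    rw [hmass hit, hW, hmass avoid, hHA, hHB, Finset.mul_sum, ← Finset.sum_sub_distrib,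
      ← Finset.sum_sub_distrib]
    refine Finset.sum_le_sum fun T _ => ?_
    by_cases hT : T ∈ E
    · have h1 : 0 ≤ ∑ s, hit s T * x s := Finset.sum_nonneg fun s _ => by
        unfold hit; split <;> simp [hx]
      have h2 : 0 ≤ ∑ s, avoid s T * x s *
        (if T s = false ∧ K * ∑ s', avoid s' T * x s' < B * x s then 1 else 0) :=
        Finset.sum_nonneg fun s _ => mul_nonneg (mul_nonneg (hd0 _ _) (hx _)) (by split <;> simp)
      simp only [if_pos hT, mul_one]
      have h3 := mul_nonneg (hy T) h1
      have h4 := mul_nonneg (hy T) h2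
      have h5 := mul_nonneg hγ.le (mul_nonneg (hy T) (hX0 T))
      linarith
    · have := mul_le_mul_of_nonneg_left (hEx T hT) (hy T)
      simp only [if_neg hT, mul_zero, Finset.sum_const_zero, sub_zero]
      linarith
  have hA : HA ≤ 1 / Real.log K * (condEnt avoid B x y + W) := by
    rw [div_mul_eq_mul_div, one_mul, le_div_iff₀ hlogK]; linarith
  have hB' : HB ≤ 1 / lam * (condEnt (fun T s => avoid s T) (2 ^ Fintype.card A) y x + W) := by
    rw [div_mul_eq_mul_div, one_mul, le_div_iff₀ hlam]; linarith
  linarith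

end Block

/-! ### Many blocks. -/

section Blocks

variable {A : Type*} [Fintype A] [DecidableEq A]

/-- The indicator that no set `t i` contains the point `s i`. -/
def disjWeight {A : Type*} {k : ℕ} (s : Fin k → A) (t : Fin k → A → Bool) : ℝ :=
  ∏ i, avoid (s i) (t i)

theorem disjWeight_eq_ite {A : Type*} {k : ℕ} (s : Fin k → A) (t : Fin k → A → Bool) :
    disjWeight s t = if ∃ i, t i (s i) = true then 0 else 1 := by
  unfold disjWeight avoid
  split_ifs with h
  · obtain ⟨i, hi⟩ := h
    exact Finset.prod_eq_zero (Finset.mem_univ i) (by simp [hi])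
  · push Not at h
    exact Finset.prod_eq_one fun i _ => if_neg (h i)

theorem disjWeight_cons {A : Type*} {k : ℕ} (s : Fin (k + 1) → A) (t : Fin (k + 1) → A → Bool) :
    disjWeight s t = avoid ((Fin.consEquiv fun _ => A).symm s).1
        ((Fin.consEquiv fun _ => A → Bool).symm t).1 *
      disjWeight ((Fin.consEquiv fun _ => A).symm s).2
        ((Fin.consEquiv fun _ => A → Bool).symm t).2 := by
  unfold disjWeight
  rw [Fin.prod_univ_succ]
  rfl

theorem sum_sum_prod_mul {S₁ S₂ T₁ T₂ : Type*} [Fintype S₁] [Fintype S₂] [Fintype T₁] [Fintype T₂]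
    (d : S₁ → T₁ → ℝ) (e : S₂ → T₂ → ℝ) :
    ∑ s : S₁ × S₂, ∑ t : T₁ × T₂, d s.1 t.1 * e s.2 t.2 =
      (∑ s, ∑ t, d s t) * ∑ s, ∑ t, e s t := by
  simp only [Fintype.sum_prod_type, Finset.sum_mul_sum]

theorem sum_sum_equiv {S₁ S₂ T₁ T₂ : Type*} [Fintype S₁] [Fintype S₂] [Fintype T₁] [Fintype T₂]
    (f : S₁ ≃ S₂) (g : T₁ ≃ T₂) (φ : S₂ → T₂ → ℝ) :
    ∑ s, ∑ t, φ (f s) (g t) = ∑ s, ∑ t, φ s t := by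
  rw [← f.sum_comp]
  exact Finset.sum_congr rfl fun s _ => g.sum_comp _

theorem sum_hit_eq_sum_avoid : ∑ s : A, ∑ T, hit s T = ∑ s : A, ∑ T, avoid s T := by
  refine Finset.sum_congr rfl fun s _ => ?_
  have hinv : Function.Involutive fun (T : A → Bool) a => !T a := fun T => by simp
  rw [← Equiv.sum_comp hinv.toPerm]
  refine Finset.sum_congr rfl fun T _ => ?_
  simp only [hit, avoid, Function.Involutive.coe_toPerm]
  by_cases h : T s = true <;> simp [h]

theorem two_mul_sum_avoid :
    2 * ∑ s : A, ∑ T, avoid s T = Fintype.card A * 2 ^ Fintype.card A := by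
  rw [two_mul]
  nth_rewrite 1 [← sum_hit_eq_sum_avoid]
  rw [← Finset.sum_add_distrib]
  simp only [← Finset.sum_add_distrib]
  have : ∀ (s : A) T, hit s T + avoid s T = 1 := fun s T => by
    unfold hit avoid; split <;> simp
  simp [this]

/-- Each block is avoided with probability 1/2, so a uniform pair is disjoint with probability `2 ^
(-k)`. This density enters the entropy bound for protocols as `P = 2 ^ k`. -/
theorem two_pow_mul_sum_disjWeight (k : ℕ) :
    2 ^ k * ∑ s : Fin k → A, ∑ t, disjWeight s t =
      (Fintype.card (Fin k → A) : ℝ) * Fintype.card (Fin k → A → Bool) := by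
  induction k with
  | zero => simp [disjWeight]
  | succ k ih =>
    simp only [disjWeight_cons]
    rw [sum_sum_equiv (Fin.consEquiv fun _ => A).symm (Fin.consEquiv fun _ => A → Bool).symm
      fun s t => avoid s.1 t.1 * disjWeight s.2 t.2]
    rw [sum_sum_prod_mul avoid disjWeight]
    have h := two_mul_sum_avoid (A := A)
    calc _ = (2 * ∑ s : A, ∑ T, avoid s T) * (2 ^ k * ∑ s : Fin k → A, ∑ t, disjWeight s t) := by
          ring
      _ = _ := by
          rw [h, ih]
          simp only [Fintype.card_pi, Finset.prod_const, Finset.card_univ, Fintype.card_fin,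
            Fintype.card_bool]
          push_cast
          ring

/-- The witness weighs the pairs that meet in exactly one block: recursively, a hit in the first
block with all others avoided, or the first avoided and one hit among the rest. Hitting and avoiding
a block are equally likely, whence the total mass `k` times that of the disjoint pairs. -/
theorem exists_corruption_blocks [Nonempty A] {κ α β : ℝ}
    (h : Corruption (avoid (A := A)) hit (Fintype.card A) (2 ^ Fintype.card A) κ α β) (k : ℕ) :
    ∃ e : (Fin k → A) → (Fin k → A → Bool) → ℝ, (∀ s t, 0 ≤ e s t) ∧
      (∀ s t, e s t ≠ 0 → ∃ i, t i (s i) = true) ∧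
      ∑ s, ∑ t, e s t = k * ∑ s : Fin k → A, ∑ t, disjWeight s t ∧
      Corruption disjWeight e (Fintype.card A ^ k) ((2 ^ Fintype.card A) ^ k) (k * κ) α β := by
  induction k with
  | zero =>
    refine ⟨fun _ _ => 0, by simp, by simp, by simp, fun x y hx hy => ?_⟩
    simp [mass, condEnt, disjWeight]
  | succ k ih =>
    obtain ⟨e, he0, hei, hes, hec⟩ := ih
    have hB : (0 : ℝ) < Fintype.card A := by exact_mod_cast Fintype.card_pos
    have hav : ∀ (s : A) T, 0 ≤ avoid s T := fun s T => by unfold avoid; split <;> simp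
    have hhit : ∀ (s : A) T, 0 ≤ hit s T := fun s T => by unfold hit; split <;> simp
    have hdw : ∀ (s : Fin k → A) t, 0 ≤ disjWeight s t := fun s t =>
      Finset.prod_nonneg fun i _ => hav _ _
    have hprod := h.prod hB (by positivity) (by positivity) (by positivity) hav hdw hec
    have hc := hprod.congr_equiv (Fin.consEquiv fun _ => A).symm
      (Fin.consEquiv fun _ => A → Bool).symm
    refine ⟨fun s t => hit ((Fin.consEquiv fun _ => A).symm s).1
        ((Fin.consEquiv fun _ => A → Bool).symm t).1 *
          disjWeight ((Fin.consEquiv fun _ => A).symm s).2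
        ((Fin.consEquiv fun _ => A → Bool).symm t).2 +
        avoid ((Fin.consEquiv fun _ => A).symm s).1
        ((Fin.consEquiv fun _ => A → Bool).symm t).1 *
          e ((Fin.consEquiv fun _ => A).symm s).2
        ((Fin.consEquiv fun _ => A → Bool).symm t).2, ?_, ?_, ?_, ?_⟩
    · exact fun s t => add_nonneg (mul_nonneg (hhit _ _) (hdw _ _)) (mul_nonneg (hav _ _) (he0 _ _))
    · intro s t hne
      by_cases h0 : t 0 (s 0) = true
      · exact ⟨0, h0⟩
      · have h1 : hit ((Fin.consEquiv fun _ => A).symm s).1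
          ((Fin.consEquiv fun _ => A → Bool).symm t).1 = 0 := if_neg h0
        simp only [h1, zero_mul, zero_add] at hne
        obtain ⟨i, hi⟩ := hei _ _ (right_ne_zero_of_mul hne)
        exact ⟨i.succ, hi⟩
    · simp only [disjWeight_cons]
      rw [sum_sum_equiv (Fin.consEquiv fun _ => A).symm (Fin.consEquiv fun _ => A → Bool).symm
          fun s t => hit s.1 t.1 * disjWeight s.2 t.2 + avoid s.1 t.1 * e s.2 t.2,
        sum_sum_equiv (Fin.consEquiv fun _ => A).symm (Fin.consEquiv fun _ => A → Bool).symm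
          fun s t => avoid s.1 t.1 * disjWeight s.2 t.2]
      simp only [Finset.sum_add_distrib]
      rw [sum_sum_prod_mul hit disjWeight, sum_sum_prod_mul avoid e,
        sum_sum_prod_mul avoid disjWeight, hes, sum_hit_eq_sum_avoid]
      push_cast
      ring
    · have hd : (disjWeight : (Fin (k + 1) → A) → (Fin (k + 1) → A → Bool) → ℝ) = fun s t =>
        avoid ((Fin.consEquiv fun _ => A).symm s).1
        ((Fin.consEquiv fun _ => A → Bool).symm t).1 *
      disjWeight ((Fin.consEquiv fun _ => A).symm s).2
        ((Fin.consEquiv fun _ => A → Bool).symm t).2 :=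
        funext fun s => funext fun t => disjWeight_cons s t
      rw [hd, pow_succ', pow_succ', Nat.cast_succ, add_mul, one_mul, add_comm (k * κ)]
      exact hc

end Blocks

/-! ### From rectangles to protocols. -/

/-- At most `Q` rectangles meet each column on average `1 / P` full, so a typical slice has density
about `1 / (Q * P)` and relative entropy about `log (Q * P)`. Precisely, `n * log (N / n) ≤ n * log
ρ + N / ρ` with `ρ = Q * P`; the first terms sum to at most `log ρ` times the mass of `d`, as the
rectangles are disjoint, and the second ones to at most that mass. -/
theorem sum_condEnt_le {S T ι : Type*} [Fintype S] [Fintype T] (d : S → T → ℝ)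
    (hd : ∀ s t, d s t = 0 ∨ d s t = 1) (L : Finset ι) (x : ι → S → ℝ) (y : ι → T → ℝ)
    (hx : ∀ m s, x m s = 0 ∨ x m s = 1) (hy : ∀ m t, y m t = 0 ∨ y m t = 1)
    (hxy : ∀ s t, ∑ m ∈ L, x m s * y m t ≤ 1) {P Q N : ℝ} (hP : 1 ≤ P) (hQ : 1 ≤ Q) (hN : 0 < N)
    (hyQ : ∀ t, ∑ m ∈ L, y m t ≤ Q) (hPd : P * ∑ s, ∑ t, d s t = N * Fintype.card T) :
    ∑ m ∈ L, condEnt d N (x m) (y m) ≤ (∑ s, ∑ t, d s t) * (Real.log (Q * P) + 1) := by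
  have hd0 : ∀ s t, 0 ≤ d s t := fun s t => by rcases hd s t with h | h <;> simp [h]
  have hx0 : ∀ m s, 0 ≤ x m s := fun m s => by rcases hx m s with h | h <;> simp [h]
  have hy0 : ∀ m t, 0 ≤ y m t := fun m s => by rcases hy m s with h | h <;> simp [h]
  set ρ := Q * P with hρ
  have hρ1 : 1 ≤ ρ := one_le_mul_of_one_le_of_one_le hQ hP
  have hρ0 : 0 < ρ := zero_lt_one.trans_le hρ1
  have hlog : 0 ≤ Real.log ρ := Real.log_nonneg hρ1
  have h1 : ∀ m t, ∑ s, d s t * x m s * Real.log (N * x m s / ∑ s', d s' t * x m s') ≤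
      (∑ s, d s t * x m s) * Real.log ρ + N / ρ := by
    intro m t
    set n := ∑ s, d s t * x m s with hn
    have hn0 : 0 ≤ n := Finset.sum_nonneg fun s _ => mul_nonneg (hd0 _ _) (hx0 _ _)
    have : ∑ s, d s t * x m s * Real.log (N * x m s / n) = n * Real.log (N / n) := by
      rw [hn, Finset.sum_mul]
      refine Finset.sum_congr rfl fun s _ => ?_
      rcases hx m s with h | h <;> simp [h]
    rw [this]
    rcases hn0.eq_or_lt with h0 | hpos
    · rw [← h0]; simp only [zero_mul, zero_add]; positivity
    · have hl := Real.log_le_sub_one_of_pos (x := N / n / ρ) (by positivity)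
      rw [Real.log_div (by positivity) hρ0.ne'] at hl
      have h2 := mul_le_mul_of_nonneg_left hl hpos.le
      have h3 : n * (N / n / ρ - 1) = N / ρ - n := by field_simp
      rw [h3] at h2
      linarith
  have h2 : ∀ m, condEnt d N (x m) (y m) ≤ mass d (x m) (y m) * Real.log ρ +
      N / ρ * ∑ t, y m t := by
    intro m
    have hm : mass d (x m) (y m) = ∑ t, y m t * ∑ s, d s t * x m s := by
      unfold mass
      rw [Finset.sum_comm]
      exact Finset.sum_congr rfl fun t _ => by rw [mul_comm, Finset.sum_mul]
    refine (Finset.sum_le_sum fun t _ => mul_le_mul_of_nonneg_left (h1 m t) (hy0 m t)).trans ?_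
    rw [hm, Finset.sum_mul, Finset.mul_sum, ← Finset.sum_add_distrib]
    exact (Finset.sum_congr rfl fun t _ => by ring).le
  refine (Finset.sum_le_sum fun m _ => h2 m).trans ?_
  rw [Finset.sum_add_distrib, ← Finset.sum_mul, ← Finset.mul_sum, Finset.sum_comm, mul_add]
  refine add_le_add (mul_le_mul_of_nonneg_right ?_ hlog) ?_
  · simp only [mass]
    rw [Finset.sum_comm]
    refine Finset.sum_le_sum fun s _ => ?_
    rw [Finset.sum_comm]
    refine Finset.sum_le_sum fun t _ => ?_
    simp only [mul_assoc]
    rw [← Finset.mul_sum]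
    exact mul_le_of_le_one_right (hd0 _ _) (hxy s t)
  · have h3 := Finset.sum_le_sum fun t (_ : t ∈ Finset.univ) => hyQ t
    rw [Finset.sum_const, Finset.card_univ, nsmul_eq_mul] at h3
    calc N / ρ * ∑ t, ∑ m ∈ L, y m t ≤ N / ρ * (Fintype.card T * Q) := by gcongr
      _ = (N * Fintype.card T) * Q / ρ := by ring
      _ = _ := by rw [← hPd, hρ]; field_simp

namespace Protocol

variable {X Y : Type}

/-- The sequence of all bits sent by the two players. -/
def transcript : Protocol X Y → X → Y → List Bool
  | output _, _, _ => []
  | alice msg next, x, y => msg x :: (next (msg x)).transcript x y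
  | bob msg next, x, y => msg y :: (next (msg y)).transcript x y

theorem run_eq_of_transcript_eq (π : Protocol X Y) {x x' : X} {y y' : Y}
    (h : π.transcript x y = π.transcript x' y') : π.run x y = π.run x' y' := by
  induction π with
  | output r => rfl
  | alice msg next ih =>
    simp only [transcript, List.cons.injEq] at h
    simp only [run, ← h.1]
    rw [← h.1] at h
    exact ih _ h.2
  | bob msg next ih =>
    simp only [transcript, List.cons.injEq] at h
    simp only [run, ← h.1]
    rw [← h.1] at h
    exact ih _ h.2

theorem transcript_rectangle (π : Protocol X Y) {x x' : X} {y y' : Y}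
    (h : π.transcript x y = π.transcript x' y') : π.transcript x y' = π.transcript x y := by
  induction π with
  | output r => rfl
  | alice msg next ih =>
    simp only [transcript, List.cons.injEq] at h ⊢
    rw [← h.1] at h
    exact ⟨trivial, ih _ h.2⟩
  | bob msg next ih =>
    simp only [transcript, List.cons.injEq] at h ⊢
    obtain ⟨hm, h⟩ := h
    rw [← hm] at h ⊢
    exact ⟨rfl, ih _ h⟩

/-- For a fixed input of Bob the tree branches only at Alice's nodes. This is the multiplicity `Q =
2 ^ a` in `sum_condEnt_le`. -/
theorem card_image_transcript_le_alice {S : Type*} (π : Protocol X Y) (f : S → X) (y : Y)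
    (F : Finset S) {a : ℕ} (ha : ∀ s ∈ F, π.aliceBits (f s) y ≤ a) :
    (F.image fun s => π.transcript (f s) y).card ≤ 2 ^ a := by
  classical
  induction π generalizing F a with
  | output r =>
    refine (Finset.card_le_one.2 ?_).trans Nat.one_le_two_pow
    intro l hl l' hl'
    simp only [transcript, Finset.mem_image] at hl hl'
    rw [← hl.choose_spec.2, ← hl'.choose_spec.2]
  | alice msg next ih =>
    rcases F.eq_empty_or_nonempty with rfl | ⟨s₀, hs₀⟩
    · simp
    obtain ⟨a, rfl⟩ : ∃ a', a = a' + 1 :=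
      ⟨a - 1, by have := ha s₀ hs₀; simp only [aliceBits] at this; omega⟩
    have hsub : (F.image fun s => (alice msg next).transcript (f s) y) ⊆
        Finset.univ.biUnion fun c : Bool => (((F.filter fun s => msg (f s) = c).image
          fun s => (next c).transcript (f s) y).image (List.cons c)) := by
      intro l hl
      obtain ⟨s, hs, rfl⟩ := Finset.mem_image.1 hl
      simp only [Finset.mem_biUnion, Finset.mem_univ, true_and, Finset.mem_image,
        Finset.mem_filter]
      exact ⟨msg (f s), _, ⟨s, ⟨hs, rfl⟩, rfl⟩, rfl⟩
    refine (Finset.card_le_card hsub).trans (Finset.card_biUnion_le.trans ?_)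
    have : ∀ c : Bool, (((F.filter fun s => msg (f s) = c).image
        fun s => (next c).transcript (f s) y).image (List.cons c)).card ≤ 2 ^ a := fun c => by
      refine Finset.card_image_le.trans (ih c _ fun s hs => ?_)
      rw [Finset.mem_filter] at hs
      have := ha s hs.1
      simp only [aliceBits, hs.2] at this
      omega
    refine (Finset.sum_le_sum fun c _ => this c).trans ?_
    simp [pow_succ, mul_comm]
  | bob msg next ih =>
    have : (F.image fun s => (bob msg next).transcript (f s) y) =
        ((F.image fun s => (next (msg y)).transcript (f s) y).image (List.cons (msg y))) := by
      rw [Finset.image_image]; rfl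
    rw [this]
    exact Finset.card_image_le.trans (ih _ _ ha)

theorem card_image_transcript_le_bob {T : Type*} (π : Protocol X Y) (x : X) (g : T → Y)
    (F : Finset T) {b : ℕ} (hb : ∀ t ∈ F, π.bobBits x (g t) ≤ b) :
    (F.image fun t => π.transcript x (g t)).card ≤ 2 ^ b := by
  classical
  induction π generalizing F b with
  | output r =>
    refine (Finset.card_le_one.2 ?_).trans Nat.one_le_two_pow
    intro l hl l' hl'
    simp only [transcript, Finset.mem_image] at hl hl'
    rw [← hl.choose_spec.2, ← hl'.choose_spec.2]
  | bob msg next ih =>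
    rcases F.eq_empty_or_nonempty with rfl | ⟨t₀, ht₀⟩
    · simp
    obtain ⟨b, rfl⟩ : ∃ b', b = b' + 1 :=
      ⟨b - 1, by have := hb t₀ ht₀; simp only [bobBits] at this; omega⟩
    have hsub : (F.image fun t => (bob msg next).transcript x (g t)) ⊆
        Finset.univ.biUnion fun c : Bool => (((F.filter fun t => msg (g t) = c).image
          fun t => (next c).transcript x (g t)).image (List.cons c)) := by
      intro l hl
      obtain ⟨t, ht, rfl⟩ := Finset.mem_image.1 hl
      simp only [Finset.mem_biUnion, Finset.mem_univ, true_and, Finset.mem_image,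
        Finset.mem_filter]
      exact ⟨msg (g t), _, ⟨t, ⟨ht, rfl⟩, rfl⟩, rfl⟩
    refine (Finset.card_le_card hsub).trans (Finset.card_biUnion_le.trans ?_)
    have : ∀ c : Bool, (((F.filter fun t => msg (g t) = c).image
        fun t => (next c).transcript x (g t)).image (List.cons c)).card ≤ 2 ^ b := fun c => by
      refine Finset.card_image_le.trans (ih c _ fun t ht => ?_)
      rw [Finset.mem_filter] at ht
      have := hb t ht.1
      simp only [bobBits, ht.2] at this
      omega
    refine (Finset.sum_le_sum fun c _ => this c).trans ?_
    simp [pow_succ, mul_comm]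
  | alice msg next ih =>
    have : (F.image fun t => (alice msg next).transcript x (g t)) =
        ((F.image fun t => (next (msg x)).transcript x (g t)).image (List.cons (msg x))) := by
      rw [Finset.image_image]; rfl
    rw [this]
    exact Finset.card_image_le.trans (ih _ _ hb)

theorem run_eq_of_bobBits_eq_zero (π : Protocol X Y) (x : X) (y y' : Y)
    (h : ∀ z, π.bobBits x z = 0) : π.run x y = π.run x y' := by
  induction π with
  | output r => rfl
  | alice msg next ih => exact ih _ h
  | bob msg next ih => exact absurd (h y) (Nat.succ_ne_zero _)

/-- A protocol with few bits errs often, either with respect to `d` or with respect to `e`. -/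
theorem error_ge {S T : Type*} [Fintype S] [Fintype T] [Nonempty S] [Nonempty T]
    (π : Protocol X Y) (f : S → X) (g : T → Y) {a b : ℕ} (ha : ∀ x y, π.aliceBits x y ≤ a)
    (hb : ∀ x y, π.bobBits x y ≤ b) (r : Bool) {d e : S → T → ℝ} {κ α β P : ℝ}
    (hd : ∀ s t, d s t = 0 ∨ d s t = 1) (hα : 0 ≤ α) (hβ : 0 ≤ β) (hP : 1 ≤ P)
    (hPd : P * ∑ s, ∑ t, d s t = (Fintype.card S : ℝ) * Fintype.card T)
    (h : Corruption d e (Fintype.card S) (Fintype.card T) κ α β) :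
    κ * (∑ s, ∑ t, d s t * if π.run (f s) (g t) = r then 1 else 0) -
      α * ((∑ s, ∑ t, d s t) * (Real.log (2 ^ a * P) + 1)) -
      β * ((∑ s, ∑ t, d s t) * (Real.log (2 ^ b * P) + 1)) ≤
      ∑ s, ∑ t, e s t * if π.run (f s) (g t) = r then 1 else 0 := by
  classical
  set tr : S → T → List Bool := fun s t => π.transcript (f s) (g t) with htr
  set L : Finset (List Bool) :=
    (Finset.univ.filter fun p : S × T => π.run (f p.1) (g p.2) = r).image fun p => tr p.1 p.2
    with hL
  -- The two sides of the rectangle of inputs with transcript `m`; only transcripts that lead to the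
  -- output `r` are kept in `L`.
  set x : List Bool → S → ℝ := fun m s => if ∃ t, tr s t = m then 1 else 0 with hx
  set y : List Bool → T → ℝ := fun m t => if ∃ s, tr s t = m then 1 else 0 with hy
  have hxy : ∀ m s t, x m s * y m t = if tr s t = m then 1 else 0 := by
    intro m s t
    simp only [hx, hy, ← ite_and, mul_ite, mul_one, mul_zero]
    refine if_congr ⟨?_, fun h => ⟨⟨s, h⟩, ⟨t, h⟩⟩⟩ rfl rfl
    rintro ⟨⟨s', h1⟩, ⟨t', h2⟩⟩
    exact (π.transcript_rectangle (h2.trans h1.symm)).trans h2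
  have hsum : ∀ s t, ∑ m ∈ L, x m s * y m t = if π.run (f s) (g t) = r then 1 else 0 := by
    intro s t
    simp only [hxy]
    rw [Finset.sum_ite_eq]
    refine if_congr ⟨fun hm => ?_, fun hr => ?_⟩ rfl rfl
    · obtain ⟨p, hp, hpe⟩ := Finset.mem_image.1 hm
      rw [← (Finset.mem_filter.1 hp).2]
      exact π.run_eq_of_transcript_eq hpe.symm
    · exact Finset.mem_image.2 ⟨(s, t), by simpa using hr, rfl⟩
  have hmass : ∀ w : S → T → ℝ, ∑ m ∈ L, mass w (x m) (y m) =
      ∑ s, ∑ t, w s t * if π.run (f s) (g t) = r then 1 else 0 := by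
    intro w
    simp only [mass]
    rw [Finset.sum_comm]
    refine Finset.sum_congr rfl fun s _ => ?_
    rw [Finset.sum_comm]
    refine Finset.sum_congr rfl fun t _ => ?_
    rw [← hsum, Finset.mul_sum]
    exact Finset.sum_congr rfl fun m _ => mul_assoc _ _ _
  have hx01 : ∀ m s, x m s = 0 ∨ x m s = 1 := fun m s => by simp only [hx]; split <;> simp
  have hy01 : ∀ m s, y m s = 0 ∨ y m s = 1 := fun m s => by simp only [hy]; split <;> simp
  have hS : (0 : ℝ) < Fintype.card S := by exact_mod_cast Fintype.card_pos
  have hT : (0 : ℝ) < Fintype.card T := by exact_mod_cast Fintype.card_pos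
  have h1 : ∑ m ∈ L, condEnt d (Fintype.card S) (x m) (y m) ≤
      (∑ s, ∑ t, d s t) * (Real.log (2 ^ a * P) + 1) := by
    refine sum_condEnt_le d hd L x y hx01 hy01 (fun s t => ?_) hP (one_le_pow₀ one_le_two) hS
      (fun t => ?_) hPd
    · rw [hsum]; split <;> simp
    · simp only [hy]
      rw [Finset.sum_boole]
      have hsub : (L.filter fun m => ∃ s, tr s t = m) ⊆
          Finset.univ.image fun s => π.transcript (f s) (g t) := by
        intro m hm
        obtain ⟨s, hs⟩ := (Finset.mem_filter.1 hm).2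
        exact Finset.mem_image.2 ⟨s, Finset.mem_univ _, hs⟩
      exact_mod_cast (Finset.card_le_card hsub).trans
        (π.card_image_transcript_le_alice f (g t) _ fun s _ => ha _ _)
  have h2 : ∑ m ∈ L, condEnt (fun t s => d s t) (Fintype.card T) (y m) (x m) ≤
      (∑ s, ∑ t, d s t) * (Real.log (2 ^ b * P) + 1) := by
    rw [Finset.sum_comm]
    refine sum_condEnt_le (fun t s => d s t) (fun t s => hd s t) L y x hy01 hx01 (fun t s => ?_) hP
      (one_le_pow₀ one_le_two) hT (fun s => ?_) ?_
    · simp only [mul_comm (y _ _)]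
      rw [hsum]; split <;> simp
    · simp only [hx]
      rw [Finset.sum_boole]
      have hsub : (L.filter fun m => ∃ t, tr s t = m) ⊆
          Finset.univ.image fun t => π.transcript (f s) (g t) := by
        intro m hm
        obtain ⟨t, ht⟩ := (Finset.mem_filter.1 hm).2
        exact Finset.mem_image.2 ⟨t, Finset.mem_univ _, ht⟩
      exact_mod_cast (Finset.card_le_card hsub).trans
        (π.card_image_transcript_le_bob (f s) g _ fun t _ => hb _ _)
    · rw [Finset.sum_comm, hPd, mul_comm]
  have h3 := Finset.sum_le_sum fun m (_ : m ∈ L) => h (x m) (y m)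
    (fun s => by rcases hx01 m s with h | h <;> simp [h])
    (fun s => by rcases hy01 m s with h | h <;> simp [h])
  simp only [Finset.sum_sub_distrib, ← Finset.mul_sum, hmass] at h3
  have h4 := mul_le_mul_of_nonneg_left h1 hα
  have h5 := mul_le_mul_of_nonneg_left h2 hβ
  linarith

end Protocol

/-! ### Lopsided set disjointness. -/

/-- If every event has probability at most `η`, then some outcome lies in at most an `η`-fraction
of the events. -/
theorem PMF.exists_mem_support_sum_le {Ω ι : Type*} [Fintype ι] (P : PMF Ω) (w : ι → ℝ)
    (hw : ∀ j, 0 ≤ w j) (E : ι → Ω → Prop) [∀ j ω, Decidable (E j ω)] {η : ℝ≥0∞} (hη : η ≠ ∞)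
    (hE : ∀ j, P.toOuterMeasure {ω | E j ω} ≤ η) :
    ∃ ω ∈ P.support, ∑ j, w j * (if E j ω then 1 else 0) ≤ η.toReal * ∑ j, w j := by
  classical
  by_contra! hcon
  set c : ℝ≥0∞ := η * ∑ j, ENNReal.ofReal (w j) with hc
  have hc_top : c ≠ ∞ := ENNReal.mul_ne_top hη (ENNReal.sum_ne_top.2 fun j _ => ENNReal.ofReal_ne_top)
  have hcr : c = ENNReal.ofReal (η.toReal * ∑ j, w j) := by
    rw [ENNReal.ofReal_mul ENNReal.toReal_nonneg, ENNReal.ofReal_toReal hη,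
      ENNReal.ofReal_sum_of_nonneg fun j _ => hw j]
  set G : Ω → ℝ≥0∞ := fun ω => ∑ j, ENNReal.ofReal (w j) * (if E j ω then 1 else 0) with hG
  have hGr : ∀ ω, G ω = ENNReal.ofReal (∑ j, w j * (if E j ω then 1 else 0)) := by
    intro ω
    rw [ENNReal.ofReal_sum_of_nonneg fun j _ => mul_nonneg (hw j) (by split <;> simp)]
    refine Finset.sum_congr rfl fun j _ => ?_
    split <;> simp
  have hlt : ∀ ω ∈ P.support, c < G ω := by
    intro ω hω
    rw [hcr, hGr]
    have h := hcon ω hω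
    refine (ENNReal.ofReal_lt_ofReal_iff (lt_of_le_of_lt ?_ h)).2 h
    exact mul_nonneg ENNReal.toReal_nonneg (Finset.sum_nonneg fun j _ => hw j)
  have hsum : ∑' ω, P ω * G ω ≤ c := by
    have : ∀ ω, P ω * G ω = ∑ j, ENNReal.ofReal (w j) * {ω | E j ω}.indicator P ω := by
      intro ω
      rw [hG, Finset.mul_sum]
      refine Finset.sum_congr rfl fun j _ => ?_
      by_cases h : E j ω <;> simp [h, mul_comm]
    simp only [this]
    rw [Summable.tsum_finsetSum fun _ _ => ENNReal.summable, hc, Finset.mul_sum]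
    refine Finset.sum_le_sum fun j _ => ?_
    rw [ENNReal.tsum_mul_left, ← PMF.toOuterMeasure_apply, mul_comm]
    exact mul_le_mul_left (hE j) _
  obtain ⟨ω₀, hω₀⟩ := P.support_nonempty
  have hPc : ∑' ω, P ω * c = c := by rw [ENNReal.tsum_mul_right, P.tsum_coe, one_mul]
  have h0 : P ω₀ ≠ 0 := (P.mem_support_iff ω₀).1 hω₀
  -- If every outcome in the support exceeded the bound, so would the expectation; one outcome of
  -- positive probability makes it strict.
  have : ∑' ω, P ω * c < ∑' ω, P ω * G ω := by
    refine ENNReal.tsum_lt_tsum (i := ω₀) (by rw [hPc]; exact hc_top) (fun ω => ?_) ?_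
    · by_cases hω : ω ∈ P.support
      · exact mul_le_mul_right (hlt ω hω).le _
      · rw [(P.apply_eq_zero_iff ω).2 hω]; simp
    · exact ENNReal.mul_lt_mul_right h0 (P.apply_ne_top ω₀) (hlt ω₀ hω₀)
  rw [hPc] at this
  exact absurd (this.trans_le hsum) (lt_irrefl _)

/-- The choice of parameters for block size `z`: with `K = z ^ (ε / 2)` and `lam = z ^ (1 - ε)` the
second condition implies `hE` of `corruption_block`, and the last two make `1 / log K` and `1 / lam`
at most `θ / 3`. -/
theorem eventually_block_parameters {ε θ : ℝ} (hε : 0 < ε) (hε1 : ε < 1) (hθ : 0 < θ) :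
    ∀ᶠ z : ℝ in Filter.atTop, 1 < z ∧ Real.log z + z ^ (1 - ε) ≤ θ ^ 2 / 4 * z ^ (1 - ε / 2) ∧
      3 / θ ≤ ε / 2 * Real.log z ∧ 3 / θ ≤ z ^ (1 - ε) := by
  have hc : 0 < θ ^ 2 / 4 / 2 := by positivity
  have h1 := (isLittleO_log_rpow_atTop (r := 1 - ε / 2) (by linarith)).bound hc
  have h2 := (tendsto_rpow_neg_atTop (y := ε / 2) (by positivity)).eventually_le_const hc
  have h3 := (Real.tendsto_log_atTop.const_mul_atTop (by positivity : 0 < ε / 2)).eventually_ge_atTop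
    (3 / θ)
  have h4 := (tendsto_rpow_atTop (y := 1 - ε) (by linarith)).eventually_ge_atTop (3 / θ)
  filter_upwards [h1, h2, h3, h4, Filter.eventually_gt_atTop 1] with z h1 h2 h3 h4 h5
  refine ⟨h5, ?_, h3, h4⟩
  have hz : 0 < z := by linarith
  rw [Real.norm_of_nonneg (by positivity : 0 ≤ z ^ (1 - ε / 2))] at h1
  have := (Real.le_norm_self _).trans h1
  have h6 : z ^ (1 - ε) ≤ θ ^ 2 / 4 / 2 * z ^ (1 - ε / 2) := by
    calc z ^ (1 - ε) = z ^ (-(ε / 2)) * z ^ (1 - ε / 2) := by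
          rw [← Real.rpow_add hz]; congr 1; ring
      _ ≤ _ := by gcongr
  linarith

/-- The lower bound for lopsided set disjointness with `k` blocks of size `2 ^ ℓ`. -/
theorem lopsidedDisjointness_lower_bound {ε : ℝ} (hε : 0 < ε) (hε1 : ε < 1) {η : ℝ≥0∞}
    (hη : η < 1 / 2) :
    ∃ c : ℝ, 0 < c ∧ ∃ ℓ₀ : ℕ, ∀ k ℓ : ℕ, 1 ≤ k → ℓ₀ ≤ ℓ →
      ∀ (X Y : Type) (F : X → Y → Prop) (P : RandomizedProtocol X Y) (a b : ℕ),
      P.Solves F η → P.AliceSendsAtMost a → P.BobSendsAtMost b →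
      ∀ (f : (Fin k → Fin ℓ → Bool) → X) (g : (Fin k → (Fin ℓ → Bool) → Bool) → Y) (r : Bool),
      (∀ s t, F (f s) (g t) ↔ ((∃ i, t i (s i) = true) ↔ r = true)) →
      c * (k * ℓ) ≤ a ∨ c * (k * ((2 : ℝ) ^ ℓ) ^ (1 - ε)) ≤ b := by
  classical
  have hηt : η ≠ ∞ := (hη.trans (by simp)).ne
  have hηr : η.toReal < 1 / 2 := by
    have := (ENNReal.toReal_lt_toReal hηt (by simp)).2 hη
    simpa using this
  -- The advantage is `5θ`. The losses are `θ` from concentration and `3α, 3β ≤ θ` from the two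
  -- entropies, so `2θ` is left to be paid by communication.
  set θ : ℝ := (1 - 2 * η.toReal) / 5 with hθ
  have hθ0 : 0 < θ := by rw [hθ]; linarith
  have hlog2 : 0 < Real.log 2 := Real.log_pos one_lt_two
  have hlog2' : Real.log 2 ≤ 1 := by linarith [Real.log_two_lt_d9]
  obtain ⟨ℓ₀, hℓ₀⟩ := Filter.eventually_atTop.1
    ((tendsto_pow_atTop_atTop_of_one_lt (one_lt_two (α := ℝ))).eventually
      (eventually_block_parameters hε hε1 hθ0))
  refine ⟨θ * min (ε / 2 * Real.log 2) 1, by positivity, ℓ₀, ?_⟩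
  intro k ℓ hk hℓ X Y F P a b hP ha hb f g r hF
  obtain ⟨hB1, hpar, hα3, hβ3⟩ := hℓ₀ ℓ hℓ
  set B : ℝ := (2 : ℝ) ^ ℓ with hB
  have hcard : (Fintype.card (Fin ℓ → Bool) : ℝ) = B := by simp [hB]
  have hB0 : 0 < B := by positivity
  have hlogB : 0 < Real.log B := Real.log_pos hB1
  have hlogK : Real.log (B ^ (ε / 2)) = ε / 2 * Real.log B := Real.log_rpow hB0 _
  have hlam0 : 0 < B ^ (1 - ε) := by positivity
  have hblock := corruption_block (A := Fin ℓ → Bool) (γ := θ) (K := B ^ (ε / 2))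
    (lam := B ^ (1 - ε)) hθ0 (Real.one_lt_rpow hB1 (by positivity)) hlam0 (by
      rw [hcard]
      nth_rewrite 1 [← Real.exp_log hB0]
      rw [← Real.exp_add, ← Real.exp_add, Real.exp_le_one_iff]
      have : θ ^ 2 * B / (4 * B ^ (ε / 2)) = θ ^ 2 / 4 * B ^ (1 - ε / 2) := by
        rw [Real.rpow_sub hB0, Real.rpow_one]; field_simp
      rw [this]; linarith)
  rw [hlogK] at hblock
  set α := 1 / (ε / 2 * Real.log B) with hα
  set β := 1 / B ^ (1 - ε) with hβ
  have hα0 : 0 < α := by positivity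
  have hβ0 : 0 < β := by positivity
  have hα3' : 3 * α ≤ θ := by
    rw [hα, mul_one_div, div_le_iff₀ (by positivity)]
    rw [div_le_iff₀ hθ0] at hα3; linarith
  have hβ3' : 3 * β ≤ θ := by
    rw [hβ, mul_one_div, div_le_iff₀ (by positivity)]
    rw [div_le_iff₀ hθ0] at hβ3; linarith
  obtain ⟨e, he0, hei, hes, hec⟩ := exists_corruption_blocks hblock k
  set N₀ : ℝ := ∑ s : Fin k → Fin ℓ → Bool, ∑ t, disjWeight s t with hN₀
  have hcount := two_pow_mul_sum_disjWeight (A := Fin ℓ → Bool) k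
  rw [← hN₀] at hcount
  have hN₀pos : 0 < N₀ := by
    have h : (0 : ℝ) < 2 ^ k * N₀ := by
      rw [hcount]
      exact mul_pos (by exact_mod_cast Fintype.card_pos) (by exact_mod_cast Fintype.card_pos)
    exact pos_of_mul_pos_right h (by positivity)
  have hd : ∀ (s : Fin k → Fin ℓ → Bool) t, disjWeight s t = 0 ∨ disjWeight s t = 1 :=
    fun s t => by rw [disjWeight_eq_ite]; split <;> simp
  have hd0 : ∀ (s : Fin k → Fin ℓ → Bool) t, 0 ≤ disjWeight s t := fun s t => by
    rcases hd s t with h | h <;> simp [h]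
  -- The hard distribution gives half its mass to disjoint pairs and half to pairs in the support of
  -- `e`.
  obtain ⟨π, hπ, herr⟩ := PMF.exists_mem_support_sum_le P
    (fun p : (Fin k → Fin ℓ → Bool) × (Fin k → (Fin ℓ → Bool) → Bool) =>
      k * disjWeight p.1 p.2 + e p.1 p.2)
    (fun p => add_nonneg (mul_nonneg (Nat.cast_nonneg k) (hd0 _ _)) (he0 _ _))
    (fun p π => ¬ (π.run (f p.1) (g p.2) = true ↔ F (f p.1) (g p.2))) hηt
    (fun p => hP _ _)
  -- The output `!r` is right on disjoint pairs and wrong on intersecting ones. A protocol that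
  -- gives it on most disjoint pairs must also give it on much of `e`.
  have hmain := π.error_ge f g (ha π hπ) (hb π hπ) (!r) (P := 2 ^ k) hd hα0.le hβ0.le
    (one_le_pow₀ one_le_two) hcount (by
      have h1 : (Fintype.card (Fin k → Fin ℓ → Bool) : ℝ) =
          (Fintype.card (Fin ℓ → Bool) : ℝ) ^ k := by
        rw [Fintype.card_fun, Fintype.card_fin, Nat.cast_pow]
      have h2 : (Fintype.card (Fin k → (Fin ℓ → Bool) → Bool) : ℝ) =
          (2 ^ Fintype.card (Fin ℓ → Bool)) ^ k := by
        rw [Fintype.card_fun (α := Fin k), Fintype.card_fin, Nat.cast_pow,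
          Fintype.card_fun (β := Bool), Fintype.card_bool, Nat.cast_pow, Nat.cast_ofNat]
      rw [h1, h2]
      exact hec)
  rw [← hN₀] at hmain
  set G := ∑ s : Fin k → Fin ℓ → Bool, ∑ t, disjWeight s t *
    (if π.run (f s) (g t) = !r then (1 : ℝ) else 0) with hG
  set H := ∑ s : Fin k → Fin ℓ → Bool, ∑ t, e s t *
    (if π.run (f s) (g t) = !r then (1 : ℝ) else 0) with hH
  have hGN : G ≤ N₀ := Finset.sum_le_sum fun s _ => Finset.sum_le_sum fun t _ =>
    mul_le_of_le_one_right (hd0 _ _) (by split <;> simp)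
  have hpoint : ∀ s t, (k * disjWeight s t + e s t) *
      (if ¬ (π.run (f s) (g t) = true ↔ F (f s) (g t))
        then (1 : ℝ) else 0) =
      k * disjWeight s t - k * (disjWeight s t * if π.run (f s) (g t) = !r then (1 : ℝ) else 0) +
        e s t * if π.run (f s) (g t) = !r then (1 : ℝ) else 0 := by
    intro s t
    simp only [hF]
    by_cases hi : ∃ i, t i (s i) = true
    · have h0 : disjWeight s t = 0 := by rw [disjWeight_eq_ite, if_pos hi]
      rw [h0]
      simp only [hi, true_iff]
      cases r <;> cases π.run (f s) (g t) <;> simp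
    · have h0 : e s t = 0 := by
        by_contra h; exact hi (hei s t h)
      rw [h0]
      simp only [hi, false_iff]
      cases r <;> cases π.run (f s) (g t) <;> simp
  have hL : ∑ p : (Fin k → Fin ℓ → Bool) × (Fin k → (Fin ℓ → Bool) → Bool),
      (k * disjWeight p.1 p.2 + e p.1 p.2) *
      (if ¬ (π.run (f p.1) (g p.2) = true ↔ F (f p.1) (g p.2))
        then (1 : ℝ) else 0) = k * N₀ - k * G + H := by
    rw [Fintype.sum_prod_type]
    simp only [hpoint, Finset.sum_add_distrib, Finset.sum_sub_distrib, ← Finset.mul_sum]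
    rw [hG, hH, hN₀]
  have hW : ∑ p : (Fin k → Fin ℓ → Bool) × (Fin k → (Fin ℓ → Bool) → Bool),
      (k * disjWeight p.1 p.2 + e p.1 p.2) = 2 * (k * N₀) := by
    rw [Fintype.sum_prod_type]
    simp only [Finset.sum_add_distrib, ← Finset.mul_sum]
    rw [hes]; ring
  rw [hL, hW] at herr
  have hk1 : (1 : ℝ) ≤ k := by exact_mod_cast hk
  -- The additive 1 is absorbed into the second `k`, since `1 ≤ k`.
  have hlogs : ∀ n : ℕ, Real.log (2 ^ n * 2 ^ k) + 1 ≤ n + 2 * k := by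
    intro n
    rw [← pow_add, Real.log_pow]
    push_cast
    have : ((n : ℝ) + k) * Real.log 2 ≤ (n + k) * 1 :=
      mul_le_mul_of_nonneg_left hlog2' (by positivity)
    linarith
  have h1 : α * (N₀ * (Real.log (2 ^ a * 2 ^ k) + 1)) ≤ N₀ * (α * (a + 2 * k)) := by
    rw [mul_left_comm]
    have := hlogs a
    gcongr
  have h2 : β * (N₀ * (Real.log (2 ^ b * 2 ^ k) + 1)) ≤ N₀ * (β * (b + 2 * k)) := by
    rw [mul_left_comm]
    have := hlogs b
    gcongr
  have h3 : (θ + α + β) * k * G ≤ (θ + α + β) * k * N₀ := by gcongr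
  have h4 : N₀ * (k * (5 * θ)) ≤ N₀ * (k * (θ + α + β) + α * (a + 2 * k) + β * (b + 2 * k)) := by
    have : 5 * θ = 1 - 2 * η.toReal := by rw [hθ]; ring
    rw [this]
    linarith
  have h5 := le_of_mul_le_mul_left h4 hN₀pos
  have h6 := mul_le_mul_of_nonneg_left hα3' (by positivity : (0 : ℝ) ≤ k)
  have h7 := mul_le_mul_of_nonneg_left hβ3' (by positivity : (0 : ℝ) ≤ k)
  have h8 : 2 * (θ * k) ≤ α * a + β * b := by linarith
  rcases le_total (θ * k) (α * a) with h | h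
  · left
    have hαa : α * a = a / (ε / 2 * Real.log B) := by rw [hα]; ring
    rw [hαa, le_div_iff₀ (by positivity), hB, Real.log_pow] at h
    refine le_trans ?_ h
    calc θ * min (ε / 2 * Real.log 2) 1 * (k * ℓ) ≤ θ * (ε / 2 * Real.log 2) * (k * ℓ) := by
          gcongr
          exact min_le_left _ _
      _ = _ := by ring
  · right
    have h9 : θ * k ≤ β * b := by linarith
    have hβb : β * b = b / B ^ (1 - ε) := by rw [hβ]; ring
    rw [hβb, le_div_iff₀ (by positivity)] at h9
    refine le_trans ?_ h9
    calc θ * min (ε / 2 * Real.log 2) 1 * (k * B ^ (1 - ε)) ≤ θ * 1 * (k * B ^ (1 - ε)) := by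
          gcongr
          exact min_le_right _ _
      _ = _ := by ring

/-! ### Reductions from disjointness to partial match. -/

section Reductions

variable {n d k ℓ : ℕ}

/-- Disjointness reduces to partial match with a single string, the characteristic vector of
Bob's set. -/
theorem exists_partialMatch_iff_disjoint (hn : 1 ≤ n) (hd : k * 2 ^ ℓ ≤ d) :
    ∃ (f : (Fin k → Fin ℓ → Bool) → Pattern d)
      (g : (Fin k → (Fin ℓ → Bool) → Bool) → Database n d), ∀ s t,
      (PartialMatch (f s) (g t) ↔ ((∃ i, t i (s i) = true) ↔ false = true)) := by
  classical
  obtain ⟨φ⟩ : Nonempty (Fin k × (Fin ℓ → Bool) ↪ Fin d) :=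
    Function.Embedding.nonempty_of_card_le (by simpa using hd)
  refine ⟨fun s c => if ∃ i, φ (i, s i) = c then some false else none,
    fun t _ c => decide (∃ i v, φ (i, v) = c ∧ t i v = true), fun s t => ?_⟩
  simp only [PartialMatch, Pattern.Matches, Bool.false_eq_true, iff_false, not_exists]
  constructor
  · rintro ⟨j, hj⟩ i hi
    have h := hj (φ (i, s i))
    rw [if_pos ⟨i, rfl⟩] at h
    simp only [reduceCtorEq, Option.some.injEq, false_or] at h
    have := of_decide_eq_false h.symm
    exact this ⟨i, s i, rfl, hi⟩
  · intro h
    refine ⟨⟨0, hn⟩, fun c => ?_⟩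
    split_ifs with hc
    · right
      obtain ⟨i, rfl⟩ := hc
      congr 1
      symm
      apply decide_eq_false
      rintro ⟨i', v, he, hv⟩
      have := φ.injective he
      rw [Prod.mk.injEq] at this
      obtain ⟨rfl, rfl⟩ := this
      exact h _ hv
    · exact Or.inl rfl

/-- Set disjointness in blocks reduces to partial match with one string for each point; the points
of a block are encoded by an antichain. -/
theorem exists_partialMatch_iff_intersect (hk : 1 ≤ k) (hℓ : 1 ≤ ℓ) (hd : k * (2 * ℓ) ≤ d)
    (hn : k * 2 ^ ℓ ≤ n) :
    ∃ (f : (Fin k → Fin ℓ → Bool) → Pattern d)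
      (g : (Fin k → (Fin ℓ → Bool) → Bool) → Database n d), ∀ s t,
      (PartialMatch (f s) (g t) ↔ ((∃ i, t i (s i) = true) ↔ true = true)) := by
  classical
  obtain ⟨φ⟩ : Nonempty (Fin k × Fin ℓ × Bool ↪ Fin d) :=
    Function.Embedding.nonempty_of_card_le (by simpa [mul_comm ℓ 2] using hd)
  obtain ⟨ψ⟩ : Nonempty (Fin k × (Fin ℓ → Bool) ↪ Fin n) :=
    Function.Embedding.nonempty_of_card_le (by simpa using hn)
  -- A present point `(i, v)` gets the string with ones exactly at `(i, l, v l)`; the pattern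
  -- demands zeros exactly at the `(i, l, b)` with `b ≠ s i l`. Slots without a present point get
  -- the all-ones string, which never matches, because `k` and `ℓ` are positive and so the pattern
  -- contains a zero.
  refine ⟨fun s c => if ∃ i l b, φ (i, l, b) = c ∧ s i l ≠ b then some false else none,
    fun t j c => decide (∀ i v, ψ (i, v) = j → t i v = true → ∃ l, φ (i, l, v l) = c),
    fun s t => ?_⟩
  simp only [PartialMatch, Pattern.Matches, iff_true]
  constructor
  · rintro ⟨j, hj⟩
    have key : ∀ i l b, s i l ≠ b → ∃ i' v, ψ (i', v) = j ∧ t i' v = true ∧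
        ∀ l', φ (i', l', v l') ≠ φ (i, l, b) := by
      intro i l b hb
      have h := hj (φ (i, l, b))
      rw [if_pos ⟨i, l, b, rfl, hb⟩] at h
      simp only [reduceCtorEq, Option.some.injEq, false_or] at h
      have := of_decide_eq_false h.symm
      push Not at this
      exact this
    obtain ⟨i, v, hψ, ht, -⟩ := key ⟨0, hk⟩ ⟨0, hℓ⟩ (!s ⟨0, hk⟩ ⟨0, hℓ⟩) (by simp)
    refine ⟨i, ?_⟩
    have : v = s i := by
      by_contra hne
      obtain ⟨l, hl⟩ := Function.ne_iff.1 hne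
      obtain ⟨i', v', hψ', -, h⟩ := key i l (v l) (Ne.symm hl)
      have := ψ.injective (hψ'.trans hψ.symm)
      rw [Prod.mk.injEq] at this
      obtain ⟨rfl, rfl⟩ := this
      exact h l rfl
    rwa [← this]
  · rintro ⟨i, hi⟩
    refine ⟨ψ (i, s i), fun c => ?_⟩
    split_ifs with hc
    · right
      obtain ⟨i', l, b, rfl, hb⟩ := hc
      congr 1
      symm
      apply decide_eq_false
      intro h
      obtain ⟨l', hl'⟩ := h i (s i) rfl hi
      have := φ.injective hl'
      simp only [Prod.mk.injEq] at this
      obtain ⟨rfl, rfl, h3⟩ := this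
      exact hb h3
    · exact Or.inl rfl

/-- The indexing problem reduces to partial match. -/
theorem exists_partialMatch_iff_index (hd : ℓ + 1 ≤ d) (hn : 2 ^ ℓ ≤ n) :
    ∃ (f : (Fin 1 → Fin ℓ → Bool) → Pattern d)
      (g : (Fin 1 → (Fin ℓ → Bool) → Bool) → Database n d), ∀ s t,
      (PartialMatch (f s) (g t) ↔ ((∃ i, t i (s i) = true) ↔ true = true)) := by
  classical
  obtain ⟨φ⟩ : Nonempty (Option (Fin ℓ) ↪ Fin d) :=
    Function.Embedding.nonempty_of_card_le (by simpa using hd)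
  obtain ⟨ψ⟩ : Nonempty ((Fin ℓ → Bool) ↪ Fin n) :=
    Function.Embedding.nonempty_of_card_le (by simpa using hn)
  -- The coordinate `none` is a presence flag, which the pattern requires to be one. Absent points
  -- and unused slots get the zero string.
  refine ⟨fun s c => if h : ∃ o, φ o = c then some (h.choose.elim true (s 0)) else none,
    fun t j c => decide (∃ v, ψ v = j ∧ t 0 v = true ∧ ∃ o : Option (Fin ℓ), φ o = c ∧
      o.elim true v = true), fun s t => ?_⟩
  have hch : ∀ o (h : ∃ o', φ o' = φ o), h.choose = o := fun o h => φ.injective h.choose_spec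
  have hmatch : ∀ j, Pattern.Matches
      (fun c => if h : ∃ o, φ o = c then some (h.choose.elim true (s 0)) else none)
      (fun c => decide (∃ v, ψ v = j ∧ t 0 v = true ∧ ∃ o : Option (Fin ℓ), φ o = c ∧
      o.elim true v = true)) ↔ ∀ o : Option (Fin ℓ), (o.elim true (s 0) = true ↔
        ∃ v, ψ v = j ∧ t 0 v = true ∧ o.elim true v = true) := by
    intro j
    simp only [Pattern.Matches]
    constructor
    · intro h o
      have := h (φ o)
      rw [dif_pos ⟨o, rfl⟩, hch] at this
      simp only [reduceCtorEq, Option.some.injEq, false_or, EmbeddingLike.apply_eq_iff_eq,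
        exists_eq_left] at this
      rw [this, decide_eq_true_iff]
    · intro h c
      split_ifs with hc
      · right
        obtain ⟨o, rfl⟩ := hc
        rw [hch]
        simp only [Option.some.injEq, EmbeddingLike.apply_eq_iff_eq, exists_eq_left]
        rw [Bool.eq_iff_iff, h o, decide_eq_true_iff]
      · exact Or.inl rfl
  simp only [PartialMatch, hmatch, iff_true, Fin.exists_fin_one]
  constructor
  · rintro ⟨j, hj⟩
    obtain ⟨v, hv, ht, -⟩ := (hj none).1 rfl
    have : s 0 = v := by
      ext l
      rw [Bool.eq_iff_iff]
      have := hj (some l)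
      simp only [Option.elim_some] at this
      rw [this]
      refine ⟨?_, fun h => ⟨v, hv, ht, h⟩⟩
      rintro ⟨v', hv', -, h⟩
      rwa [← ψ.injective (hv'.trans hv.symm)]
    rwa [this]
  · intro h
    refine ⟨ψ (s 0), fun o => ⟨fun ho => ⟨s 0, rfl, h, ho⟩, ?_⟩⟩
    rintro ⟨v, hv, -, ho⟩
    rwa [← ψ.injective hv]

end Reductions

/-! ### The communication lower bound for partial match. -/

/-- Bob has to send at least one bit. -/
theorem one_le_of_solves_partialMatch {n d : ℕ} (hn : 1 ≤ n) (hd : 1 ≤ d) {η : ℝ≥0∞}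
    (hη : η < 1 / 2) {b : ℕ} {P : RandomizedProtocol (Pattern d) (Database n d)}
    (hP : P.Solves PartialMatch η) (hb : P.BobSendsAtMost b) : 1 ≤ b := by
  classical
  have hηt : η ≠ ∞ := (hη.trans (by simp)).ne
  have hηr : η.toReal < 1 / 2 := by
    have := (ENNReal.toReal_lt_toReal hηt (by simp)).2 hη
    simpa using this
  by_contra hb0
  have hb0 : b = 0 := by omega
  subst hb0
  let q : Pattern d := fun _ => some true
  let D : Bool → Database n d := fun c _ _ => c
  obtain ⟨π, hπ, h⟩ := PMF.exists_mem_support_sum_le P (fun _ : Bool => (1 : ℝ)) (by simp)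
    (fun c π => ¬ (π.run q (D c) = true ↔ PartialMatch q (D c))) hηt (fun c => hP _ _)
  have hrun : π.run q (D true) = π.run q (D false) :=
    π.run_eq_of_bobBits_eq_zero _ _ _ fun z => Nat.le_zero.1 (hb π hπ q z)
  have h1 : PartialMatch q (D true) := ⟨⟨0, hn⟩, fun _ => Or.inr rfl⟩
  have h2 : ¬ PartialMatch q (D false) := by
    rintro ⟨j, hj⟩
    have := hj ⟨0, hd⟩
    simp [q, D] at this
  simp only [Fintype.sum_bool, hrun, h1, h2, one_mul] at h
  cases hr : π.run q (D false) <;> simp [hr] at h <;> linarith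

/-- For bounded `n`, one bit of Bob suffices. If `d ≥ n ^ (1 - ε)`, about `d` blocks of constant
size are placed in a single string. If `d < 2 * log n`, one block of about `n` points is indexed.
Otherwise about `d / log n` blocks of about `n / k` points are used; there `k ≤ n ^ (1 - ε)` keeps
`ℓ` of order `log n`, so that `k * ℓ` is of order `d`. -/
theorem communication_of_lt_one {ε : ℝ} (hε : 0 < ε) (hε1 : ε < 1) {η : ℝ≥0∞} (hη : η < 1 / 2) :
    ∃ c : ℝ, 0 < c ∧ ∀ n d : ℕ, 1 ≤ n → n ≤ 2 ^ d →
      ∀ (a b : ℕ) (P : RandomizedProtocol (Pattern d) (Database n d)),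
        P.Solves PartialMatch η → P.AliceSendsAtMost a → P.BobSendsAtMost b →
          c * (d : ℝ) ≤ (a : ℝ) ∨ c * (n : ℝ) ^ (1 - ε) ≤ (b : ℝ) := by
  obtain ⟨c₀, hc₀, ℓ₀, hlsd⟩ := lopsidedDisjointness_lower_bound hε hε1 hη
  have hε' : 0 < 1 - ε := by linarith
  set ℓ₁ := max ℓ₀ 1 with hℓ₁
  -- The first bound makes the block lengths of the last two cases large enough for the disjointness
  -- bound; the second ensures `2 ^ ℓ₁ ≤ n ^ (1 - ε)`, so that a constant-size block fits when `d`
  -- is large.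
  obtain ⟨L₀, hL₀⟩ := exists_nat_ge (max ((ℓ₁ + 2) / (ε / 2)) (ℓ₁ / (1 - ε)))
  set c := min (min (1 / 2 ^ L₀) (c₀ / 2 ^ (ℓ₁ + 1))) (min (c₀ / 4) (c₀ * ε / 8)) with hc
  have hcpos : 0 < c := by positivity
  have hc1 : c ≤ 1 / 2 ^ L₀ := (min_le_left _ _).trans (min_le_left _ _)
  have hc2 : c ≤ c₀ / 2 ^ (ℓ₁ + 1) := (min_le_left _ _).trans (min_le_right _ _)
  have hc3 : c ≤ c₀ / 4 := (min_le_right _ _).trans (min_le_left _ _)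
  have hc4 : c ≤ c₀ * ε / 8 := (min_le_right _ _).trans (min_le_right _ _)
  refine ⟨c, hcpos, fun n d hn hnd a b P hP ha hb => ?_⟩
  have hn1 : (1 : ℝ) ≤ n := by exact_mod_cast hn
  have hn0 : (0 : ℝ) < n := by linarith
  rcases Nat.eq_zero_or_pos d with rfl | hd
  · left; simp
  rcases lt_or_ge n (2 ^ L₀) with hsmall | hlarge
  · right
    have h1 : 1 ≤ b := one_le_of_solves_partialMatch hn hd hη hP hb
    have h2 : (n : ℝ) ^ (1 - ε) ≤ 2 ^ L₀ := by
      calc (n : ℝ) ^ (1 - ε) ≤ (n : ℝ) ^ (1 : ℝ) := Real.rpow_le_rpow_of_exponent_le hn1 (by linarith)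
        _ = n := Real.rpow_one _
        _ ≤ _ := by exact_mod_cast hsmall.le
    calc c * (n : ℝ) ^ (1 - ε) ≤ 1 / 2 ^ L₀ * 2 ^ L₀ := by gcongr
      _ = 1 := by field_simp
      _ ≤ b := by exact_mod_cast h1
  set L := Nat.log 2 n with hL
  have hLn : 2 ^ L ≤ n := Nat.pow_log_le_self 2 (by omega)
  have hnL : n < 2 ^ (L + 1) := Nat.lt_pow_succ_log_self (by norm_num) n
  have hLL : L₀ ≤ L := Nat.le_log_of_pow_le (by norm_num) hlarge
  have hLd : L ≤ d := (Nat.pow_le_pow_iff_right (by norm_num)).1 (hLn.trans hnd)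
  have hLr : (L₀ : ℝ) ≤ L := by exact_mod_cast hLL
  have hL1 : (ℓ₁ : ℝ) + 2 ≤ ε / 2 * L := by
    have := ((le_max_left _ _).trans hL₀).trans hLr
    rw [div_le_iff₀ (by positivity)] at this
    linarith
  have hL2 : (ℓ₁ : ℝ) ≤ (1 - ε) * L := by
    have := ((le_max_right _ _).trans hL₀).trans hLr
    rw [div_le_iff₀ hε'] at this
    linarith
  have hLpow : ∀ x : ℝ, 0 ≤ x → (2 : ℝ) ^ (x * L) ≤ (n : ℝ) ^ x := by
    intro x hx
    have : (2 : ℝ) ^ L ≤ n := by exact_mod_cast hLn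
    calc (2 : ℝ) ^ (x * L) = ((2 : ℝ) ^ L) ^ x := by
          rw [mul_comm, Real.rpow_mul (by norm_num), Real.rpow_natCast]
      _ ≤ _ := Real.rpow_le_rpow (by positivity) this hx
  have hℓ₁0 : ℓ₀ ≤ ℓ₁ := le_max_left _ _
  have hℓ₁1 : 1 ≤ ℓ₁ := le_max_right _ _
  rcases le_or_gt ((n : ℝ) ^ (1 - ε)) d with hbig | hlow
  · have h1 : (2 : ℝ) ^ ℓ₁ ≤ d := by
      refine le_trans ?_ hbig
      refine le_trans ?_ (hLpow _ hε'.le)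
      rw [← Real.rpow_natCast]
      exact Real.rpow_le_rpow_of_exponent_le (by norm_num) hL2
    have h1' : 2 ^ ℓ₁ ≤ d := by exact_mod_cast h1
    set k := d / 2 ^ ℓ₁ with hk
    have hk1 : 1 ≤ k := (Nat.one_le_div_iff (by positivity)).2 h1'
    have hkd : (d : ℝ) ≤ k * 2 ^ (ℓ₁ + 1) := by
      have h2 : d < 2 ^ ℓ₁ * (k + 1) := Nat.lt_mul_div_succ d (by positivity)
      have h3 : 2 ^ ℓ₁ * (k + 1) ≤ 2 ^ ℓ₁ * (2 * k) := Nat.mul_le_mul_left _ (by omega)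
      have h4 : d ≤ k * 2 ^ (ℓ₁ + 1) := by rw [pow_succ]; linarith
      exact_mod_cast h4
    have hck : c * d ≤ c₀ * k := by
      calc c * d ≤ c₀ / 2 ^ (ℓ₁ + 1) * (k * 2 ^ (ℓ₁ + 1)) := by gcongr
        _ = c₀ * k := by field_simp
    obtain ⟨f, g, hfg⟩ := exists_partialMatch_iff_disjoint (n := n) hn (Nat.div_mul_le_self d (2 ^ ℓ₁))
    rcases hlsd k ℓ₁ hk1 hℓ₁0 _ _ PartialMatch P a b hP ha hb f g false hfg with h | h
    · left
      refine hck.trans (le_trans ?_ h)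
      have : (1 : ℝ) ≤ ℓ₁ := by exact_mod_cast hℓ₁1
      exact mul_le_mul_of_nonneg_left (le_mul_of_one_le_right (by positivity) this) hc₀.le
    · right
      refine (mul_le_mul_of_nonneg_left hbig hcpos.le).trans (hck.trans (le_trans ?_ h))
      have : (1 : ℝ) ≤ ((2 : ℝ) ^ ℓ₁) ^ (1 - ε) :=
        Real.one_le_rpow (one_le_pow₀ one_le_two) hε'.le
      exact mul_le_mul_of_nonneg_left (le_mul_of_one_le_right (by positivity) this) hc₀.le
  -- Bob's bound needs only that the blocks use a constant fraction of the `n` strings.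
  have hbob : ∀ k ℓ : ℕ, 1 ≤ k → n ≤ 4 * (k * 2 ^ ℓ) →
      c * (n : ℝ) ^ (1 - ε) ≤ c₀ * (k * ((2 : ℝ) ^ ℓ) ^ (1 - ε)) := by
    intro k ℓ hk h
    have hk1 : (1 : ℝ) ≤ k := by exact_mod_cast hk
    have h' : (n : ℝ) / 4 ≤ k * 2 ^ ℓ := by
      have : (n : ℝ) ≤ 4 * (k * 2 ^ ℓ) := by exact_mod_cast h
      linarith
    have h4 : (4 : ℝ) ^ (1 - ε) ≤ 4 := by
      calc (4 : ℝ) ^ (1 - ε) ≤ (4 : ℝ) ^ (1 : ℝ) :=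
            Real.rpow_le_rpow_of_exponent_le (by norm_num) (by linarith)
        _ = 4 := Real.rpow_one _
    calc c * (n : ℝ) ^ (1 - ε) ≤ c₀ / 4 * (n : ℝ) ^ (1 - ε) := by gcongr
      _ = c₀ * ((n : ℝ) ^ (1 - ε) / 4) := by ring
      _ ≤ c₀ * ((n : ℝ) ^ (1 - ε) / 4 ^ (1 - ε)) := by gcongr
      _ = c₀ * ((n : ℝ) / 4) ^ (1 - ε) := by rw [Real.div_rpow hn0.le (by norm_num)]
      _ ≤ c₀ * (k * 2 ^ ℓ) ^ (1 - ε) := by gcongr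
      _ = c₀ * ((k : ℝ) ^ (1 - ε) * ((2 : ℝ) ^ ℓ) ^ (1 - ε)) := by
          rw [Real.mul_rpow (by positivity) (by positivity)]
      _ ≤ c₀ * ((k : ℝ) ^ (1 : ℝ) * ((2 : ℝ) ^ ℓ) ^ (1 - ε)) := by
          have := Real.rpow_le_rpow_of_exponent_le hk1 (by linarith : 1 - ε ≤ 1)
          gcongr
      _ = _ := by rw [Real.rpow_one]
  have hεL : ε / 2 * L ≤ L / 2 := by
    have : (0 : ℝ) ≤ L := by positivity
    nlinarith
  have hL3 : ℓ₁ + 2 ≤ L := by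
    have : (ℓ₁ : ℝ) + 2 ≤ L := by
      have : (0 : ℝ) ≤ L := by positivity
      linarith
    exact_mod_cast this
  rcases lt_or_ge d (2 * L) with hd2 | hd2
  · obtain ⟨M, hM⟩ : ∃ M, L = M + 1 := ⟨L - 1, by omega⟩
    obtain ⟨f, g, hfg⟩ := exists_partialMatch_iff_index (n := n) (d := d) (ℓ := M) (by omega)
      (le_trans (Nat.pow_le_pow_right (by norm_num) (by omega)) hLn)
    rcases hlsd 1 M le_rfl (by omega) _ _ PartialMatch P a b hP ha hb f g true hfg with h | h
    · left
      refine le_trans ?_ h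
      have : (d : ℝ) ≤ 4 * M := by
        have : d ≤ 4 * M := by omega
        exact_mod_cast this
      calc c * d ≤ c₀ / 4 * (4 * M) := by gcongr
        _ = _ := by push_cast; ring
    · right
      refine (hbob 1 M le_rfl ?_).trans h
      rw [hM] at hnL
      calc n ≤ 2 ^ (M + 1 + 1) := hnL.le
        _ = _ := by ring
  · have hLpos : 0 < L := by omega
    set k := d / (2 * L) with hk
    have hk1 : 1 ≤ k := (Nat.one_le_div_iff (by positivity)).2 hd2
    have hkd : k * (2 * L) ≤ d := Nat.div_mul_le_self d (2 * L)
    have hdk : d ≤ 4 * (k * L) := by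
      have h2 : d < 2 * L * (k + 1) := Nat.lt_mul_div_succ d (by positivity)
      nlinarith
    have hkdr : (k : ℝ) ≤ d := by exact_mod_cast Nat.div_le_self d (2 * L)
    have hkn : (k : ℝ) ≤ (n : ℝ) ^ (1 - ε) := hkdr.trans hlow.le
    have hk0 : (0 : ℝ) < k := by exact_mod_cast hk1
    have hkn' : k ≤ n := by
      have : (k : ℝ) ≤ n := hkn.trans
        ((Real.rpow_le_rpow_of_exponent_le hn1 (by linarith : 1 - ε ≤ 1)).trans
          (Real.rpow_one _).le)
      exact_mod_cast this
    set ℓ := Nat.log 2 (n / k) with hℓ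
    have hnk : 1 ≤ n / k := (Nat.one_le_div_iff hk1).2 hkn'
    have h1 : k * 2 ^ ℓ ≤ n := by
      have : 2 ^ ℓ ≤ n / k := Nat.pow_log_le_self 2 (by omega)
      rw [mul_comm]
      exact (Nat.le_div_iff_mul_le hk1).1 this
    have h2 : n < k * 2 ^ (ℓ + 1) := by
      have : n / k < 2 ^ (ℓ + 1) := Nat.lt_pow_succ_log_self (by norm_num) _
      rw [mul_comm]
      exact (Nat.div_lt_iff_lt_mul hk1).1 this
    have hℓL : ℓ ≤ L := Nat.log_mono_right (Nat.div_le_self n k)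
    have hℓlow : ε * L ≤ ℓ + 1 := by
      have h3 : (n : ℝ) < k * 2 ^ (ℓ + 1) := by exact_mod_cast h2
      have h4 : (n : ℝ) ^ ε * (n : ℝ) ^ (1 - ε) = n := by
        rw [← Real.rpow_add hn0]; simp
      have h5 : (n : ℝ) ^ ε < 2 ^ (ℓ + 1) := by
        by_contra hcon
        push Not at hcon
        have : (k : ℝ) * 2 ^ (ℓ + 1) ≤ (n : ℝ) ^ (1 - ε) * (n : ℝ) ^ ε := by gcongr
        linarith
      have h6 : (2 : ℝ) ^ (ε * L) < (2 : ℝ) ^ (((ℓ + 1 : ℕ) : ℝ)) := by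
        rw [Real.rpow_natCast]
        exact (hLpow ε hε.le).trans_lt h5
      have := (Real.rpow_lt_rpow_left_iff (by norm_num : (1 : ℝ) < 2)).1 h6
      push_cast at this
      exact this.le
    have hℓlow' : ε / 2 * L ≤ ℓ := by
      have : (0 : ℝ) ≤ ℓ₁ := by positivity
      linarith
    have hℓ1 : ℓ₁ ≤ ℓ := by
      have : (ℓ₁ : ℝ) ≤ ℓ := by linarith
      exact_mod_cast this
    obtain ⟨f, g, hfg⟩ := exists_partialMatch_iff_intersect (n := n) (d := d) (ℓ := ℓ) hk1
      (hℓ₁1.trans hℓ1)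
      (le_trans (Nat.mul_le_mul_left _ (Nat.mul_le_mul_left _ hℓL)) hkd) h1
    rcases hlsd k ℓ hk1 (hℓ₁0.trans hℓ1) _ _ PartialMatch P a b hP ha hb f g true hfg with h | h
    · left
      refine le_trans ?_ h
      have h3 : (d : ℝ) ≤ 4 * (k * L) := by exact_mod_cast hdk
      calc c * d ≤ c₀ * ε / 8 * (4 * (k * L)) := by gcongr
        _ = c₀ * (k * (ε / 2 * L)) := by ring
        _ ≤ _ := by gcongr
    · right
      refine (hbob k ℓ hk1 ?_).trans h
      rw [pow_succ] at h2
      linarith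

theorem partialMatch_communication {ε : ℝ} (hε : 0 < ε) {η : ℝ≥0∞} (hη : η < 1 / 2) :
    ∃ c : ℝ, 0 < c ∧ ∀ n d : ℕ, 1 ≤ n → n ≤ 2 ^ d →
      ∀ (a b : ℕ) (P : RandomizedProtocol (Pattern d) (Database n d)),
        P.Solves PartialMatch η → P.AliceSendsAtMost a → P.BobSendsAtMost b →
          c * (d : ℝ) ≤ (a : ℝ) ∨ c * (n : ℝ) ^ (1 - ε) ≤ (b : ℝ) := by
  obtain ⟨c, hc, h⟩ := communication_of_lt_one (ε := min ε (1 / 2)) (by positivity)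
    ((min_le_right _ _).trans_lt (by norm_num)) hη
  refine ⟨c, hc, fun n d hn hnd a b P hP ha hb => (h n d hn hnd a b P hP ha hb).imp_right ?_⟩
  refine le_trans (mul_le_mul_of_nonneg_left ?_ hc.le)
  exact Real.rpow_le_rpow_of_exponent_le (by exact_mod_cast hn) (by linarith [min_le_left ε (1 / 2)])

/-! ### From data structures to protocols. -/

namespace Protocol

variable {X Y : Type}

/-- Alice sends the `m` bits `u x`. -/
def sendAlice : (m : ℕ) → (X → Fin m → Bool) → ((Fin m → Bool) → Protocol X Y) → Protocol X Y
  | 0, _, next => next Fin.elim0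
  | m + 1, u, next => alice (fun x => u x 0) fun c =>
      sendAlice m (fun x => Fin.tail (u x)) fun v => next (Fin.cons c v)

/-- Bob sends the `m` bits `u y`. -/
def sendBob : (m : ℕ) → (Y → Fin m → Bool) → ((Fin m → Bool) → Protocol X Y) → Protocol X Y
  | 0, _, next => next Fin.elim0
  | m + 1, u, next => bob (fun y => u y 0) fun c =>
      sendBob m (fun y => Fin.tail (u y)) fun v => next (Fin.cons c v)

theorem sendAlice_spec (m : ℕ) (u : X → Fin m → Bool) (next : (Fin m → Bool) → Protocol X Y)
    (x : X) (y : Y) :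
    (sendAlice m u next).run x y = (next (u x)).run x y ∧
    (sendAlice m u next).aliceBits x y = m + (next (u x)).aliceBits x y ∧
    (sendAlice m u next).bobBits x y = (next (u x)).bobBits x y := by
  induction m with
  | zero =>
    have : u x = Fin.elim0 := funext fun i => i.elim0
    simp [sendAlice, this]
  | succ m ih =>
    obtain ⟨h1, h2, h3⟩ := ih (fun x => Fin.tail (u x)) fun v => next (Fin.cons (u x 0) v)
    rw [Fin.cons_self_tail] at h1 h2 h3
    refine ⟨h1, ?_, h3⟩
    simp only [sendAlice, aliceBits]
    rw [h2]; omega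

theorem sendBob_spec (m : ℕ) (u : Y → Fin m → Bool) (next : (Fin m → Bool) → Protocol X Y)
    (x : X) (y : Y) :
    (sendBob m u next).run x y = (next (u y)).run x y ∧
    (sendBob m u next).aliceBits x y = (next (u y)).aliceBits x y ∧
    (sendBob m u next).bobBits x y = m + (next (u y)).bobBits x y := by
  induction m with
  | zero =>
    have : u y = Fin.elim0 := funext fun i => i.elim0
    simp [sendBob, this]
  | succ m ih =>
    obtain ⟨h1, h2, h3⟩ := ih (fun y => Fin.tail (u y)) fun v => next (Fin.cons (u y 0) v)
    rw [Fin.cons_self_tail] at h1 h2 h3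
    refine ⟨h1, h2, ?_⟩
    simp only [sendBob, bobBits]
    rw [h3]; omega

end Protocol

section Simulation

variable {X Y : Type} {S w m : ℕ}

/-- The name of the cell that is probed next. -/
def ProbeTree.address (code : Fin S → Fin m → Bool) : ProbeTree S w → Fin m → Bool
  -- A stopped algorithm keeps sending a dummy address, so all executions have the same length. The
  -- dummy need not name a cell, hence the default in `Memory.lookup`.
  | answer _ => fun _ => false
  | probe i _ => code i

/-- The state of the query algorithm after the contents of the probed cell are known. -/
def ProbeTree.advance (v : Fin w → Bool) : ProbeTree S w → ProbeTree S w
  | answer r => answer r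
  | probe _ next => next v

/-- The answer, once the query algorithm has stopped. -/
def ProbeTree.result : ProbeTree S w → Bool
  | answer r => r
  | probe _ _ => false

open Classical in
/-- The contents of the cell with a given name. -/
noncomputable def Memory.lookup (code : Fin S → Fin m → Bool) (M : Memory S w) (u : Fin m → Bool) :
    Fin w → Bool :=
  if h : ∃ i, code i = u then M h.choose else fun _ => false

/-- The simulation of a query algorithm by a protocol: Alice sends the name of the cell to be
probed, and Bob sends its contents. -/
noncomputable def simulate (code : Fin S → Fin m → Bool) (encode : Y → Memory S w) :
    ℕ → (X → ProbeTree S w) → Protocol X Y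
  -- Alice's final bit announces the answer; it is the `+ 1` in her bit count.
  | 0, q => Protocol.alice (fun x => (q x).result) Protocol.output
  | t + 1, q => Protocol.sendAlice m (fun x => (q x).address code) fun u =>
      Protocol.sendBob w (fun y => (encode y).lookup code u) fun v =>
        simulate code encode t fun x => (q x).advance v

theorem simulate_aliceBits (code : Fin S → Fin m → Bool) (encode : Y → Memory S w) (t : ℕ)
    (q : X → ProbeTree S w) (x : X) (y : Y) :
    (simulate code encode t q).aliceBits x y = t * m + 1 := by
  induction t generalizing q with
  | zero => simp [simulate, Protocol.aliceBits]
  | succ t ih =>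
    rw [simulate, (Protocol.sendAlice_spec _ _ _ _ _).2.1, (Protocol.sendBob_spec _ _ _ _ _).2.1, ih]
    ring

theorem simulate_bobBits (code : Fin S → Fin m → Bool) (encode : Y → Memory S w) (t : ℕ)
    (q : X → ProbeTree S w) (x : X) (y : Y) :
    (simulate code encode t q).bobBits x y = t * w := by
  induction t generalizing q with
  | zero => simp [simulate, Protocol.bobBits]
  | succ t ih =>
    rw [simulate, (Protocol.sendAlice_spec _ _ _ _ _).2.2, (Protocol.sendBob_spec _ _ _ _ _).2.2, ih]
    ring

theorem simulate_run {code : Fin S → Fin m → Bool} (hcode : Function.Injective code)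
    (encode : Y → Memory S w) (t : ℕ) (q : X → ProbeTree S w) (x : X) (y : Y)
    (h : (q x).probes (encode y) ≤ t) :
    (simulate code encode t q).run x y = (q x).run (encode y) := by
  induction t generalizing q with
  | zero =>
    simp only [simulate, Protocol.run]
    cases hq : q x with
    | answer r => rfl
    | probe i next => rw [hq] at h; simp [ProbeTree.probes] at h
  | succ t ih =>
    rw [simulate, (Protocol.sendAlice_spec _ _ _ _ _).1, (Protocol.sendBob_spec _ _ _ _ _).1]
    cases hq : q x with
    | answer r =>
      rw [ih _ (by simp [hq, ProbeTree.advance, ProbeTree.probes])]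
      simp [hq, ProbeTree.advance]
    | probe i next =>
      have hl : (encode y).lookup code (code i) = encode y i := by
        have he : ∃ i', code i' = code i := ⟨i, rfl⟩
        rw [Memory.lookup, dif_pos he, hcode he.choose_spec]
      rw [hq] at h
      simp only [ProbeTree.probes] at h
      rw [ih]
      · simp only [hq, ProbeTree.advance, ProbeTree.address, hl, ProbeTree.run]
      · simp only [hq, ProbeTree.advance, ProbeTree.address, hl]
        omega

/-- A data structure with query time `t` yields a protocol with `t` rounds. -/
theorem RandomizedCellProbe.exists_protocol (hS : S ≤ 2 ^ m) {f : X → Y → Prop} {η : ℝ≥0∞} {t : ℕ}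
    (P : RandomizedCellProbe X Y S w) (hP : P.Solves f η) (ht : P.HasQueryTime t) :
    ∃ Q : RandomizedProtocol X Y, Q.Solves f η ∧ Q.AliceSendsAtMost (t * m + 1) ∧
      Q.BobSendsAtMost (t * w) := by
  obtain ⟨code⟩ : Nonempty (Fin S ↪ (Fin m → Bool)) :=
    Function.Embedding.nonempty_of_card_le (by simpa using hS)
  refine ⟨P.map fun A => simulate code A.encode t A.query, fun x y => ?_, fun π hπ x y => ?_,
    fun π hπ x y => ?_⟩
  · rw [PMF.toOuterMeasure_map_apply]
    refine (PMF.toOuterMeasure_mono P ?_).trans (hP x y)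
    rintro A ⟨hA, hAs⟩ hcon
    exact hA (by
      change (simulate code A.encode t A.query).run x y = true ↔ f x y
      rw [simulate_run code.injective _ _ _ _ _ (ht A hAs x y)]
      exact hcon)
  · obtain ⟨A, -, rfl⟩ := (PMF.mem_support_map_iff _ _ _).1 hπ
    exact (simulate_aliceBits _ _ _ _ _ _).le
  · obtain ⟨A, -, rfl⟩ := (PMF.mem_support_map_iff _ _ _).1 hπ
    exact (simulate_bobBits _ _ _ _ _ _).le

end Simulation

/-- The communication bound is used with `ε / 2`: for large `n` the spare factor `n ^ (ε / 2)` beats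
`C / c`, so Bob's `t * w` bits are too few and Alice must send at least `c * d` bits. -/
theorem partialMatch_cellProbe {ε : ℝ} (hε : 0 < ε) {η : ℝ≥0∞} (hη : η < 1 / 2) :
    ∃ c : ℝ, 0 < c ∧ ∀ C : ℝ, 0 < C → ∃ n₀ : ℕ,
      ∀ n d : ℕ, n₀ ≤ n → n ≤ 2 ^ d →
      ∀ t w S : ℕ, 1 ≤ t → (w : ℝ) ≤ C * (n : ℝ) ^ (1 - ε) / (t : ℝ) →
      ∀ P : RandomizedCellProbe (Pattern d) (Database n d) S w,
        P.Solves PartialMatch η → P.HasQueryTime t →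
          (2 : ℝ) ^ (c * (d : ℝ) / (t : ℝ)) ≤ (S : ℝ) := by
  obtain ⟨c, hc, hcomm⟩ := partialMatch_communication (ε := ε / 2) (by positivity) hη
  -- Rounding up costs `clog S ≤ 2 * logb 2 S` and the answer bit at most another `t * logb 2 S`, so
  -- `c / 3` would already do.
  refine ⟨c / 4, by positivity, fun C hC => ?_⟩
  obtain ⟨d₀, hd₀⟩ := exists_nat_gt (1 / c)
  have hev : ∀ᶠ n : ℕ in Filter.atTop, C / c < (n : ℝ) ^ (ε / 2) ∧ 2 ^ d₀ ≤ n :=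
    (((tendsto_rpow_atTop (by positivity : 0 < ε / 2)).comp
      tendsto_natCast_atTop_atTop).eventually_gt_atTop _).and (Filter.eventually_ge_atTop _)
  obtain ⟨n₀, hn₀⟩ := Filter.eventually_atTop.1 hev
  refine ⟨n₀, fun n d hn hnd t w S ht hw P hP hq => ?_⟩
  obtain ⟨h1, h2⟩ := hn₀ n hn
  have hn1 : 1 ≤ n := Nat.one_le_two_pow.trans h2
  have hn0 : (0 : ℝ) < n := by exact_mod_cast hn1
  have ht0 : (0 : ℝ) < t := by exact_mod_cast ht
  have hd : d₀ ≤ d := (Nat.pow_le_pow_iff_right (by norm_num)).1 (h2.trans hnd)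
  have hcd : 1 < c * d := by
    have : (d₀ : ℝ) ≤ d := by exact_mod_cast hd
    rw [div_lt_iff₀ hc] at hd₀
    nlinarith
  obtain ⟨Q, hQ, hQa, hQb⟩ := P.exists_protocol (Nat.le_pow_clog (by norm_num) S) hP hq
  have hlt : ((t * w : ℕ) : ℝ) < c * (n : ℝ) ^ (1 - ε / 2) := by
    rw [le_div_iff₀ ht0] at hw
    have h3 : (n : ℝ) ^ (1 - ε / 2) = (n : ℝ) ^ (ε / 2) * (n : ℝ) ^ (1 - ε) := by
      rw [← Real.rpow_add hn0]; congr 1; ring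
    have h4 : 0 < (n : ℝ) ^ (1 - ε) := by positivity
    rw [div_lt_iff₀ hc] at h1
    push_cast
    rw [h3]
    nlinarith [mul_lt_mul_of_pos_right h1 h4]
  rcases hcomm n d hn1 hnd _ _ Q hQ hQa hQb with h | h
  swap
  · exact absurd h (not_le.2 hlt)
  -- If names were empty, Alice would send a single bit, but `n₀` was chosen so that `c * d > 1`.
  have hm : Nat.clog 2 S ≠ 0 := by
    intro h0
    rw [h0] at h
    norm_num at h
    linarith
  have hS : 1 < S := by
    by_contra hS
    exact hm (Nat.clog_of_right_le_one (by omega) 2)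
  have hS0 : (0 : ℝ) < S := by exact_mod_cast (by omega : 0 < S)
  obtain ⟨m, hmS⟩ := Nat.exists_eq_succ_of_ne_zero hm
  have hpow : 2 ^ m < S := by
    have := Nat.pow_pred_clog_lt_self (b := 2) (by norm_num) hS
    rwa [hmS] at this
  have hlog1 : (m : ℝ) ≤ Real.logb 2 S := by
    rw [Real.le_logb_iff_rpow_le (by norm_num) hS0, Real.rpow_natCast]
    exact_mod_cast hpow.le
  have hlog2 : 1 ≤ Real.logb 2 S := by
    rw [Real.le_logb_iff_rpow_le (by norm_num) hS0, Real.rpow_one]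
    exact_mod_cast hS
  rw [← Real.le_logb_iff_rpow_le (by norm_num) hS0, div_le_iff₀ ht0]
  rw [hmS] at h
  push_cast at h
  have ht1 : (1 : ℝ) ≤ t := by exact_mod_cast ht
  have h5 : (t : ℝ) * (m + 1) ≤ t * (2 * Real.logb 2 S) := by
    apply mul_le_mul_of_nonneg_left _ ht0.le
    linarith
  have h6 : 1 ≤ (t : ℝ) * Real.logb 2 S := one_le_mul_of_one_le_of_one_le ht1 hlog2
  linarith

theorem mainTheorem4 (ε : ℝ) (hε : 0 < ε) (η : ℝ≥0∞) (hη : η < 1 / 2) :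
    (∃ c : ℝ, 0 < c ∧
      ∀ n d : ℕ, 1 ≤ n → n ≤ 2 ^ d →
      ∀ (a b : ℕ) (P : RandomizedProtocol (Pattern d) (Database n d)),
        P.Solves PartialMatch η → P.AliceSendsAtMost a → P.BobSendsAtMost b →
          c * (d : ℝ) ≤ (a : ℝ) ∨ c * (n : ℝ) ^ (1 - ε) ≤ (b : ℝ)) ∧
    (∃ c : ℝ, 0 < c ∧ ∀ C : ℝ, 0 < C → ∃ n₀ : ℕ,
      ∀ n d : ℕ, n₀ ≤ n → n ≤ 2 ^ d →
      ∀ t w S : ℕ, 1 ≤ t → (w : ℝ) ≤ C * (n : ℝ) ^ (1 - ε) / (t : ℝ) →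
      ∀ P : RandomizedCellProbe (Pattern d) (Database n d) S w,
        P.Solves PartialMatch η → P.HasQueryTime t →
          (2 : ℝ) ^ (c * (d : ℝ) / (t : ℝ)) ≤ (S : ℝ)) :=
  ⟨partialMatch_communication hε hη, partialMatch_cellProbe hε hη⟩
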